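/- Let $A$ be a unital $C^*$-algebra and $H$ a complex Hilbert space. Let $\mathcal X=\mathrm{CB}(A,B(H))$ be the space of completely bounded linear maps and $\mathcal C=\mathrm{CP}(A,B(H))\subseteq\mathcal X$ the cone of completely positive maps. For $\phi,\psi\in\mathcal C$ let $\beta(\phi,\psi)=\inf_\pi\inf\{\|V-W\|\}$ be the Bures distance, where $\pi:A\to B(K)$ runs over the unital $*$-representations of $A$ and $V,W\in B(H,K)$ over the operators with $\phi(a)=V^*\pi(a)V$ and $\psi(a)=W^*\pi(a)W$ for all $a\in A$. A universal regular model is a pair $(K,\tau)$ of a Hilbert space $K$ and an algebra homomorphism $\tau:A\to B(K)$ (not assumed unital or $*$-preserving) with $\tau(u)^*\tau(u)=\tau(1)^*\tau(1)$ and $\tau(u)\tau(u)^*=\tau(1)\tau(1)^*$ for all unitaries $u\in A$, such that for every $\psi\in\mathcal X$ with $\|\psi\|_{cb}\le 1$ there is an isometry $V\in B(H,K)$ with $\psi(a)=V^*\tau(a)V$ for all $a\in A$. Given such a model, let $\mathscr R_\tau(0)=\{0\}$ and, for $0\ne\phi\in\mathcal X$, let $\mathscr R_\tau(\phi)$ be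 the set of all $\|\phi\|_{cb}^{1/2}V$ with $V\in B(H,K)$ an isometry such that $\|\phi\|_{cb}^{-1}\phi(a)=V^*\tau(a)V$ for all $a\in A$. Let $\mathscr F_\tau(\phi)=\{2^{-1/2}(W,\tau(1)W): W\in\mathscr R_\tau(\phi)\}\subseteq B(H,K\oplus K)$, where $K\oplus K$ is the Hilbert space direct sum, let $c_+(\tau)=\sqrt{1+\|\tau(1)\|^2}/\sqrt2$, and put $$\delta_{\mathrm{reg}}(\phi,\psi)=\sup_{(K,\tau)}\frac{1}{c_+(\tau)}\,d_H\bigl(\mathscr F_\tau(\phi),\mathscr F_\tau(\psi)\bigr),\qquad \rho(\phi)=\delta_{\mathrm{reg}}(\phi,0)\qquad(\phi,\psi\in\mathcal X),$$ where the supremum is over all universal regular models and $d_H$ is the Hausdorff distance for the operator norm. Fix $\theta\in\mathcal C$, $\lambda>0$, $\alpha\in(0,1]$ and $p\in[1,\infty]$. For $\eta\in\mathcal C$ put $\kappa_\theta(\phi)(\eta)=\beta(\phi,\eta)-\beta(\theta,\eta)$ if $\phi\in\mathcal C$, and $\kappa_\theta(\phi)=0$ if $\phi\in\mathcal X\setminus\mathcal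 C$. Let $\widetilde\delta_{\mathrm{reg}}(\phi,\psi)$ be $0$ if $\phi,\psi\in\mathcal C$, $\rho(\phi)$ if only $\psi\in\mathcal C$, $\rho(\psi)$ if only $\phi\in\mathcal C$, and $\delta_{\mathrm{reg}}(\phi,\psi)$ if $\phi,\psi\notin\mathcal C$. Let $$\beta^{BK}_{\theta,\lambda,p,\alpha}(\phi,\psi)=\Bigl\|\bigl(\sup_{\eta\in\mathcal C}|\kappa_\theta(\phi)(\eta)-\kappa_\theta(\psi)(\eta)|,\ \lambda\,\widetilde\delta_{\mathrm{reg}}(\phi,\psi)^\alpha\bigr)\Bigr\|_{\ell^p(\mathbb R^2)}\qquad(\phi,\psi\in\mathcal X).$$ Let $\mathcal Y=(\mathcal X\setminus\mathcal C)\sqcup\{*\}$, with $d_{\mathrm{reg}}(\phi,\psi)=\lambda\,\delta_{\mathrm{reg}}(\phi,\psi)^\alpha$ and $d_{\mathrm{reg}}(\phi,*)=d_{\mathrm{reg}}(*,\phi)=\lambda\rho(\phi)^\alpha$ for $\phi,\psi\in\mathcal X\setminus\mathcal C$, and $d_{\mathrm{reg}}(*,*)=0$. For pointed metric spaces $(M_1,d_1,m_0)$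 and $(M_2,d_2,n_0)$, the $\ell^p$ metric wedge $M_1\vee_pM_2$ is the quotient of $M_1\sqcup M_2$ by $m_0\sim n_0$ with the metric that equals $d_i$ on $M_i$ and $\|(d_1(x,m_0),d_2(y,n_0))\|_{\ell^p}$ between $x\in M_1$ and $y\in M_2$. **Theorem.** $(\mathcal C,\beta)$, $(\mathcal Y,d_{\mathrm{reg}})$ and $(\mathcal X,\beta^{BK}_{\theta,\lambda,p,\alpha})$ are metric spaces, and $(\mathcal X,\beta^{BK}_{\theta,\lambda,p,\alpha})$ is isometric to the $\ell^p$ metric wedge $\mathcal C\vee_p\mathcal Y$ of $(\mathcal C,\beta,\theta)$ and $(\mathcal Y,d_{\mathrm{reg}},*)$, via the bijection $J:\mathcal X\to\mathcal C\vee_p\mathcal Y$ that is the identity on $\mathcal C$ and on $\mathcal X\setminus\mathcal C\subseteq\mathcal Y$. Explicitly, for all $\phi,\psi\in\mathcal X$, $$\beta^{BK}_{\theta,\lambda,p,\alpha}(\phi,\psi)=\begin{cases}\beta(\phi,\psi),&\phi,\psi\in\mathcal C,\\ d_{\mathrm{reg}}(\phi,\psi)=\lambda\,\delta_{\mathrm{reg}}(\phi,\psi)^\alpha,&\phi,\psi\notin\mathcal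 C,\\ \|(\beta(\phi,\theta),d_{\mathrm{reg}}(\psi,*))\|_{\ell^p}=\|(\beta(\phi,\theta),\lambda\rho(\psi)^\alpha)\|_{\ell^p},&\phi\in\mathcal C,\ \psi\notin\mathcal C,\\ \|(\beta(\psi,\theta),d_{\mathrm{reg}}(\phi,*))\|_{\ell^p}=\|(\beta(\psi,\theta),\lambda\rho(\phi)^\alpha)\|_{\ell^p},&\psi\in\mathcal C,\ \phi\notin\mathcal C.\end{cases}$$ -/

import Mathlib

open scoped ENNReal CStarAlgebra InnerProduct

universe u v w

noncomputable section

/-! ### The `ℓ^p`-norm on `ℝ²` and the `ℓ^p` metric wedge -/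

/-- The norm of the vector `(a, b)` in `ℓ^p(ℝ²)`. -/
def lpPair (p : ℝ≥0∞) [Fact (1 ≤ p)] (a b : ℝ) : ℝ :=
  ‖(WithLp.toLp p (a, b) : WithLp p (ℝ × ℝ))‖

lemma lpPair_left (p : ℝ≥0∞) [Fact (1 ≤ p)] {a : ℝ} (ha : 0 ≤ a) : lpPair p a 0 = a := by
  rw [lpPair, WithLp.norm_toLp_fst, Real.norm_of_nonneg ha]

lemma lpPair_right (p : ℝ≥0∞) [Fact (1 ≤ p)] {b : ℝ} (hb : 0 ≤ b) : lpPair p 0 b = b := by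
  rw [lpPair, WithLp.norm_toLp_snd, Real.norm_of_nonneg hb]

lemma lpPair_add_le (p : ℝ≥0∞) [Fact (1 ≤ p)] (a b c d : ℝ) :
    lpPair p (a + c) (b + d) ≤ lpPair p a b + lpPair p c d :=
  norm_add_le (WithLp.toLp p (a, b)) (WithLp.toLp p (c, d))

lemma lpPair_mono (p : ℝ≥0∞) [Fact (1 ≤ p)] {a b c d : ℝ} (ha : 0 ≤ a) (hb : 0 ≤ b)
    (hac : a ≤ c) (hbd : b ≤ d) : lpPair p a b ≤ lpPair p c d := by
  have hc := ha.trans hac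
  have hd := hb.trans hbd
  have h₁ : ‖a‖ ≤ ‖c‖ := by rwa [Real.norm_of_nonneg ha, Real.norm_of_nonneg hc]
  have h₂ : ‖b‖ ≤ ‖d‖ := by rwa [Real.norm_of_nonneg hb, Real.norm_of_nonneg hd]
  rcases eq_or_ne p ∞ with rfl | hp
  · simp only [lpPair, WithLp.prod_norm_eq_sup]
    exact sup_le_sup h₁ h₂
  · have hp0 : 0 < p.toReal :=
      ENNReal.toReal_pos (zero_lt_one.trans_le (Fact.out : 1 ≤ p)).ne' hp
    simp only [lpPair, WithLp.prod_norm_eq_add hp0]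
    gcongr
    exacts [h₁, h₂]

lemma lpPair_left_le (p : ℝ≥0∞) [Fact (1 ≤ p)] {a b : ℝ} (ha : 0 ≤ a) (hb : 0 ≤ b) :
    a ≤ lpPair p a b :=
  (lpPair_left p ha).ge.trans (lpPair_mono p ha le_rfl le_rfl hb)

lemma lpPair_right_le (p : ℝ≥0∞) [Fact (1 ≤ p)] {a b : ℝ} (ha : 0 ≤ a) (hb : 0 ≤ b) :
    b ≤ lpPair p a b :=
  (lpPair_right p hb).ge.trans (lpPair_mono p le_rfl hb ha le_rfl)

section Wedge

variable {M₁ M₂ : Type*}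

/-- The identification `m₀ ∼ n₀` in the disjoint union `M₁ ⊔ M₂`. -/
inductive WedgeRel (m₀ : M₁) (n₀ : M₂) : M₁ ⊕ M₂ → M₁ ⊕ M₂ → Prop
  | glue : WedgeRel m₀ n₀ (Sum.inl m₀) (Sum.inr n₀)

/-- The underlying set of the `ℓ^p` wedge of `(M₁, m₀)` and `(M₂, n₀)`: the quotient of `M₁ ⊔ M₂`
in which `m₀` and `n₀` are identified. The exponent is recorded for the metric below. -/
def LpWedge (_p : ℝ≥0∞) (m₀ : M₁) (n₀ : M₂) : Type _ := Quot (WedgeRel m₀ n₀)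

/-- The canonical map `M₁ → M₁ ∨_p M₂`. -/
def LpWedge.inl (p : ℝ≥0∞) (m₀ : M₁) (n₀ : M₂) (x : M₁) : LpWedge p m₀ n₀ := Quot.mk _ (Sum.inl x)

/-- The canonical map `M₂ → M₁ ∨_p M₂`. -/
def LpWedge.inr (p : ℝ≥0∞) (m₀ : M₁) (n₀ : M₂) (y : M₂) : LpWedge p m₀ n₀ := Quot.mk _ (Sum.inr y)

variable [MetricSpace M₁] [MetricSpace M₂]

/-- The wedge distance on representatives in `M₁ ⊔ M₂`. -/
def wedgePreDist (p : ℝ≥0∞) [Fact (1 ≤ p)] (m₀ : M₁) (n₀ : M₂) : M₁ ⊕ M₂ → M₁ ⊕ M₂ → ℝ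
  | Sum.inl x, Sum.inl y => dist x y
  | Sum.inr x, Sum.inr y => dist x y
  | Sum.inl x, Sum.inr y => lpPair p (dist x m₀) (dist y n₀)
  | Sum.inr x, Sum.inl y => lpPair p (dist y m₀) (dist x n₀)

/-- The wedge distance `d_{∨,p}` on `M₁ ∨_p M₂`. -/
def wedgeDist (p : ℝ≥0∞) [Fact (1 ≤ p)] (m₀ : M₁) (n₀ : M₂) (x y : LpWedge p m₀ n₀) : ℝ :=
  Quot.lift₂ (wedgePreDist p m₀ n₀)
    (by
      rintro (a | a) _ _ ⟨⟩
      · simp [wedgePreDist, lpPair_left]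
      · simp [wedgePreDist, lpPair_right])
    (by
      rintro _ _ (a | a) ⟨⟩
      · simp [wedgePreDist, lpPair_left, dist_comm]
      · simp [wedgePreDist, lpPair_right, dist_comm])
    x y

/-- The `ℓ^p` metric wedge. -/
instance LpWedge.instMetricSpace (p : ℝ≥0∞) [Fact (1 ≤ p)] (m₀ : M₁) (n₀ : M₂) :
    MetricSpace (LpWedge p m₀ n₀) where
  dist := wedgeDist p m₀ n₀
  dist_self := by
    rintro ⟨x | x⟩
    · exact dist_self x
    · exact dist_self x
  dist_comm := by
    rintro ⟨x | x⟩ ⟨y | y⟩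
    · exact dist_comm x y
    · rfl
    · rfl
    · exact dist_comm x y
  dist_triangle := by
    have add_l : ∀ (x y : M₁) (z : M₂), lpPair p (dist x m₀) (dist z n₀) ≤
        dist x y + lpPair p (dist y m₀) (dist z n₀) := fun x y z => by
      have h := lpPair_add_le p (dist x y) 0 (dist y m₀) (dist z n₀)
      rw [lpPair_left p dist_nonneg, zero_add] at h
      exact (lpPair_mono p dist_nonneg dist_nonneg (dist_triangle x y m₀) le_rfl).trans h
    have add_r : ∀ (x : M₁) (y z : M₂), lpPair p (dist x m₀) (dist z n₀) ≤
        dist z y + lpPair p (dist x m₀) (dist y n₀) := fun x y z => by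
      have h := lpPair_add_le p 0 (dist z y) (dist x m₀) (dist y n₀)
      rw [lpPair_right p dist_nonneg, zero_add] at h
      exact (lpPair_mono p dist_nonneg dist_nonneg le_rfl (dist_triangle z y n₀)).trans h
    have l_le : ∀ (x : M₁) (y : M₂), dist x m₀ ≤ lpPair p (dist x m₀) (dist y n₀) :=
      fun x y => lpPair_left_le p dist_nonneg dist_nonneg
    have r_le : ∀ (x : M₁) (y : M₂), dist y n₀ ≤ lpPair p (dist x m₀) (dist y n₀) :=
      fun x y => lpPair_right_le p dist_nonneg dist_nonneg
    rintro ⟨x | x⟩ ⟨y | y⟩ ⟨z | z⟩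
    · exact dist_triangle x y z
    · exact add_l x y z
    · exact (dist_triangle_right x z m₀).trans (add_le_add (l_le x y) (l_le z y))
    · change lpPair p (dist x m₀) (dist z n₀) ≤ lpPair p (dist x m₀) (dist y n₀) + dist y z
      linarith [add_r x y z, dist_comm y z]
    · change lpPair p (dist z m₀) (dist x n₀) ≤ lpPair p (dist y m₀) (dist x n₀) + dist y z
      linarith [add_l z y x, dist_comm y z]
    · exact (dist_triangle_right x z n₀).trans (add_le_add (r_le y x) (r_le y z))
    · exact add_r z y x
    · exact dist_triangle x y z
  eq_of_dist_eq_zero := by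
    have key : ∀ (x : M₁) (y : M₂), lpPair p (dist x m₀) (dist y n₀) = 0 →
        LpWedge.inl p m₀ n₀ x = LpWedge.inr p m₀ n₀ y := fun x y h => by
      have hx : x = m₀ := dist_le_zero.1 (h ▸ lpPair_left_le p dist_nonneg dist_nonneg)
      have hy : y = n₀ := dist_le_zero.1 (h ▸ lpPair_right_le p dist_nonneg dist_nonneg)
      subst hx hy
      exact Quot.sound WedgeRel.glue
    rintro ⟨x | x⟩ ⟨y | y⟩ h
    · exact congrArg (LpWedge.inl p m₀ n₀) (eq_of_dist_eq_zero (h : dist x y = 0))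
    · exact key x y h
    · exact (key y x h).symm
    · exact congrArg (LpWedge.inr p m₀ n₀) (eq_of_dist_eq_zero (h : dist x y = 0))

end Wedge

/-! ### Completely bounded and completely positive maps -/

section Maps

variable (A : Type u) [CStarAlgebra A] [PartialOrder A] [StarOrderedRing A]
variable (H : Type v) [NormedAddCommGroup H] [InnerProductSpace ℂ H] [CompleteSpace H]

/-- The space `𝒳 = CB(A, B(H))` of completely bounded linear maps: the amplifications
`M_n(A) → M_n(B(H))` are bounded uniformly in `n`. -/
def CBMaps : Submodule ℂ (A →ₗ[ℂ] (H →L[ℂ] H)) where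
  carrier := {φ | ∃ C : ℝ, ∀ (n : ℕ) (M : CStarMatrix (Fin n) (Fin n) A), ‖M.map φ‖ ≤ C * ‖M‖}
  add_mem' := by
    rintro φ ψ ⟨C, hC⟩ ⟨D, hD⟩
    refine ⟨C + D, fun n M => ?_⟩
    have h : M.map (φ + ψ) = M.map φ + M.map ψ := by ext; simp
    rw [h, add_mul]
    exact (norm_add_le _ _).trans (add_le_add (hC n M) (hD n M))
  zero_mem' := by
    refine ⟨0, fun n M => ?_⟩
    have h : M.map (0 : A →ₗ[ℂ] (H →L[ℂ] H)) = 0 := by ext; simp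
    rw [h, norm_zero, zero_mul]
  smul_mem' := by
    rintro c φ ⟨C, hC⟩
    refine ⟨‖c‖ * C, fun n M => ?_⟩
    have h : M.map (c • φ) = c • M.map φ := by ext; simp
    rw [h, norm_smul, mul_assoc]
    exact mul_le_mul_of_nonneg_left (hC n M) (norm_nonneg c)

/-- The cone `𝒞 = CP(A, B(H)) ⊆ CB(A, B(H))` of completely positive maps. -/
def CPCone : Set (CBMaps A H) :=
  {φ | ∃ Φ : A →CP (H →L[ℂ] H), Φ.toLinearMap = (φ : A →ₗ[ℂ] (H →L[ℂ] H))}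

variable {A H}

/-- The cb-norm `‖φ‖_cb = sup_n ‖φ^(n)‖`. -/
def cbNorm (φ : CBMaps A H) : ℝ :=
  sSup {r : ℝ | ∃ (n : ℕ) (M : CStarMatrix (Fin n) (Fin n) A), ‖M‖ ≤ 1 ∧
    r = ‖M.map (φ : A →ₗ[ℂ] (H →L[ℂ] H))‖}

/-! ### The Bures distance -/

variable (A) in
/-- A representation of `A`: a unital `*`-homomorphism `π : A → B(K)` with `K` a Hilbert space. -/
structure HilbertRep where
  /-- the Hilbert space of the representation -/
  K : Type w
  [normed : NormedAddCommGroup K]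
  [inner : InnerProductSpace ℂ K]
  [complete : CompleteSpace K]
  /-- the `*`-homomorphism -/
  π : A →⋆ₐ[ℂ] (K →L[ℂ] K)

attribute [instance] HilbertRep.normed HilbertRep.inner HilbertRep.complete

/-- The set `𝒮_π(φ)` of all `V : H → K` with `φ(a) = V* π(a) V` for all `a`. -/
def stinespringSet (r : HilbertRep.{u, w} A) (φ : CBMaps A H) : Set (H →L[ℂ] r.K) :=
  {V | ∀ a : A, (φ : A →ₗ[ℂ] (H →L[ℂ] H)) a = ContinuousLinearMap.adjoint V ∘L r.π a ∘L V}

/-- `β_π(φ, ψ) = inf {‖V - W‖ : V ∈ 𝒮_π(φ), W ∈ 𝒮_π(ψ)}`, which is `∞` if one of the sets is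
empty. -/
def buresRep (r : HilbertRep.{u, w} A) (φ ψ : CBMaps A H) : ℝ≥0∞ :=
  ⨅ V ∈ stinespringSet r φ, ⨅ W ∈ stinespringSet r ψ, ENNReal.ofReal ‖V - W‖

/-- The Bures distance `β(φ, ψ) = inf_π β_π(φ, ψ)` on `𝒞`. The universe `max u v` contains, up to
unitary equivalence, every representation generated by the ranges of two operators on `H`. -/
def bures (φ ψ : CPCone A H) : ℝ :=
  (⨅ r : HilbertRep.{u, max u v} A, buresRep r φ.1 ψ.1).toReal

/-! ### Regular models and the regular coordinate -/

variable (A H) in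
/-- A universal regular model `(K, τ)` for `CC(A, B(H))`: a (not necessarily unital or
`*`-preserving) algebra homomorphism `τ : A → B(K)` which is regular, and such that every completely
contractive `ψ` is of the form `ψ(a) = V* τ(a) V` with an isometry `V : H → K`. -/
structure UnivRegModel where
  /-- the Hilbert space of the model -/
  K : Type w
  [normed : NormedAddCommGroup K]
  [inner : InnerProductSpace ℂ K]
  [complete : CompleteSpace K]
  /-- the regular homomorphism -/
  τ : A →ₙₐ[ℂ] (K →L[ℂ] K)
  regular : ∀ u ∈ unitary A,
    star (τ u) * τ u = star (τ 1) * τ 1 ∧ τ u * star (τ u) = τ 1 * star (τ 1)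
  universal : ∀ ψ : CBMaps A H, cbNorm ψ ≤ 1 → ∃ V : H →L[ℂ] K, Isometry V ∧
    ∀ a : A, (ψ : A →ₗ[ℂ] (H →L[ℂ] H)) a = ContinuousLinearMap.adjoint V ∘L τ a ∘L V

attribute [instance] UnivRegModel.normed UnivRegModel.inner UnivRegModel.complete

/-- The set `ℛ_τ(φ)`: all `‖φ‖_cb^{1/2} V` with `V` an isometry implementing `φ / ‖φ‖_cb` if
`φ ≠ 0`, and `{0}` if `φ = 0`. -/
def implementers (m : UnivRegModel.{u, v, w} A H) (φ : CBMaps A H) : Set (H →L[ℂ] m.K) :=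
  {W | (φ = 0 ∧ W = 0) ∨ (φ ≠ 0 ∧ ∃ V : H →L[ℂ] m.K, Isometry V ∧
    (∀ a : A, ((cbNorm φ : ℂ)⁻¹ • (φ : A →ₗ[ℂ] (H →L[ℂ] H))) a =
      ContinuousLinearMap.adjoint V ∘L m.τ a ∘L V) ∧
    W = ((√(cbNorm φ) : ℝ) : ℂ) • V)}

/-- `Γ_τ(W) = 2^{-1/2} (W, T_τ W) : H → K ⊕ K`, with `T_τ = τ(1)` and the Hilbert direct sum. -/
def gammaMap (m : UnivRegModel.{u, v, w} A H) (W : H →L[ℂ] m.K) :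
    H →L[ℂ] WithLp 2 (m.K × m.K) :=
  ((1 / √2 : ℝ) : ℂ) • ((WithLp.prodContinuousLinearEquiv 2 ℂ m.K m.K).symm :
    (m.K × m.K) →L[ℂ] WithLp 2 (m.K × m.K)) ∘L (W.prod (m.τ 1 ∘L W))

/-- The set `ℱ_τ(φ) = Γ_τ(ℛ_τ(φ))`. -/
def featureSet (m : UnivRegModel.{u, v, w} A H) (φ : CBMaps A H) :
    Set (H →L[ℂ] WithLp 2 (m.K × m.K)) :=
  gammaMap m '' implementers m φ

/-- `δ_reg^τ(φ, ψ)`: the Hausdorff distance of `ℱ_τ(φ)` and `ℱ_τ(ψ)` for the operator norm. -/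
def deltaRegModel (m : UnivRegModel.{u, v, w} A H) (φ ψ : CBMaps A H) : ℝ :=
  Metric.hausdorffDist (featureSet m φ) (featureSet m ψ)

/-- `c_+(τ) = (1 + ‖T_τ‖²)^{1/2} / 2^{1/2}`. -/
def cPlus (m : UnivRegModel.{u, v, w} A H) : ℝ := √(1 + ‖m.τ 1‖ ^ 2) / √2

/-- `δ_reg(φ, ψ)`: the supremum over all universal regular models of `δ_reg^τ(φ, ψ) / c_+(τ)`.
Restricting to a reducing subspace shows that larger universes give the same supremum. -/
def deltaReg (φ ψ : CBMaps A H) : ℝ :=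
  ⨆ m : UnivRegModel.{u, v, max u v} A H, 1 / cPlus m * deltaRegModel m φ ψ

/-- `ρ(φ) = δ_reg(φ, 0)`. -/
def rho (φ : CBMaps A H) : ℝ := deltaReg φ 0

/-! ### The Bures--Kuratowski distance -/

open Classical in
/-- `κ_θ(φ)(η) = β(φ, η) - β(θ, η)` for `φ ∈ 𝒞`, and `κ_θ(φ) = 0` for `φ ∉ 𝒞`. -/
def kappa (θ : CPCone A H) (φ : CBMaps A H) (η : CPCone A H) : ℝ :=
  if h : φ ∈ CPCone A H then bures ⟨φ, h⟩ η - bures θ η else 0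

/-- `‖κ_θ(φ) - κ_θ(ψ)‖_∞`. -/
def kappaDist (θ : CPCone A H) (φ ψ : CBMaps A H) : ℝ :=
  ⨆ η : CPCone A H, |kappa θ φ η - kappa θ ψ η|

open Classical in
/-- The collapsed regular coordinate. -/
def deltaRegTilde (φ ψ : CBMaps A H) : ℝ :=
  if φ ∈ CPCone A H then
    if ψ ∈ CPCone A H then 0 else rho ψ
  else
    if ψ ∈ CPCone A H then rho φ else deltaReg φ ψ

/-- The Bures--Kuratowski distance `β^{BK}_{θ,λ,p,α}` on `𝒳`. -/
def buresKuratowski (θ : CPCone A H) (lam : ℝ) (p : ℝ≥0∞) [Fact (1 ≤ p)] (α : ℝ)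
    (φ ψ : CBMaps A H) : ℝ :=
  lpPair p (kappaDist θ φ ψ) (lam * deltaRegTilde φ ψ ^ α)

/-! ### The collapsed non-CP space -/

variable (A H) in
/-- The non-CP locus with an added basepoint: `𝒴 = (𝒳 ∖ 𝒞) ⊔ {∗}`. -/
inductive NonCPSpace : Type (max u v)
  | base : NonCPSpace
  | of (φ : CBMaps A H) (hφ : φ ∉ CPCone A H) : NonCPSpace

/-- The distance `d_reg` on `𝒴`. -/
def dReg (lam α : ℝ) : NonCPSpace A H → NonCPSpace A H → ℝ
  | .of φ _, .of ψ _ => lam * deltaReg φ ψ ^ α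
  | .of φ _, .base => lam * rho φ ^ α
  | .base, .of ψ _ => lam * rho ψ ^ α
  | .base, .base => 0

end Maps

end

/-!
The formulas for `β^{BK}` are bookkeeping once `β` and `δ_reg` are known to be metrics, and the
metric on `𝒳` is the wedge metric transported along the bijection `J`.

If `φ` and `ψ` are completely positive, the second coordinate of `β^{BK}` vanishes and the first one
is the distance of `φ` and `ψ` under the Kuratowski embedding, which is isometric because the
supremum is attained at `η = ψ` (`iSup_abs_bures_sub`). If neither is, the first coordinate
vanishes. In the mixed case the first coordinate is `β(φ, θ)` by the same argument.

That `β` is a metric rests on one construction: a positive kernel with values in the functionals on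
`A` is the kernel `⟨v x, π(·) (v y)⟩` of vectors in a representation (`exists_kernelRep`). It gives
the Stinespring dilations, their direct sums, and, for the triangle inequality, the amalgamation of
two representations along a common minimal dilation (`exists_amalgam_stinespring`), after which
`‖V - X‖ ≤ ‖V - W‖ + ‖W - X‖` can be used in one representation.

Small values of `β` and of `δ_reg` both provide implementing operators `V`, `W` with `V - W` small,
so definiteness follows in both cases from the estimate `norm_compression_sub_le` for
`V* T V - W* T W`. For `δ_reg`, the symmetry, the triangle inequality and finiteness are those of the Hausdorff distance of nonempty sets that are
bounded uniformly over all models (`deltaRegModel_le`). Definiteness needs one universal regular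
model to exist (`nonempty_univRegModel`), that is, a dilation theorem for completely bounded maps.
A complete contraction `φ` is the off-diagonal block of a positive kernel whose diagonal blocks take
the value `δ_ij` at `1` (`exists_cbKernel`): the prescribed values are extended by the M. Riesz
theorem, and they are positive by a Cauchy--Schwarz estimate (`re_sum_inner_map_nonneg`) for
matrices over `A` with scalar Gram matrix. So `φ = S* π(·) T` with isometries `S`, `T`, and a block
sum over all `φ` makes `π` independent of `φ`. Two isometries become one in `K ⊕ K ⊕ K`: the
homomorphism `τ = B π(·) C` with `C B = 1` is regular when `B* B` and `C C*` are scalars, and `B`,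
`C` can be chosen so that `S = B* V` and `T = C V` for an isometry `V` (`exists_model_isometry`).

Finally `d_reg` is the snowflake `λ δ_reg ^ α`, restricted to `(𝒳 ∖ 𝒞) ∪ {0}`; the point `0` can
serve as the base point because it lies in `𝒞`.
-/

noncomputable section

open scoped ComplexOrder InnerProductSpace
open UniformSpace

/-! ### Positive kernels and the representations they generate -/

section Kernel

variable {A : Type u} [CStarAlgebra A] {X : Type v}

/-- The sesquilinear form `(f, g) ↦ ∑ k(x, y)(f(x)* g(y))` on finitely supported functions `X → A`
attached to a kernel `k` on `X` with values in the linear functionals on `A`. -/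
def kernelForm (k : X → X → A →ₗ[ℂ] ℂ) (f g : X →₀ A) : ℂ :=
  f.sum fun x a => g.sum fun y b => k x y (star a * b)

/-- A kernel is positive if its form is positive semidefinite. -/
def IsPosKernel (k : X → X → A →ₗ[ℂ] ℂ) : Prop := ∀ f : X →₀ A, 0 ≤ kernelForm k f f

variable {k : X → X → A →ₗ[ℂ] ℂ}

lemma kernelForm_add_left (f f' g : X →₀ A) :
    kernelForm k (f + f') g = kernelForm k f g + kernelForm k f' g := by
  classical
  refine Finsupp.sum_add_index' (by simp) fun x a b => ?_
  simp [add_mul, Finsupp.sum_add]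

lemma kernelForm_add_right (f g g' : X →₀ A) :
    kernelForm k f (g + g') = kernelForm k f g + kernelForm k f g' := by
  classical
  rw [kernelForm, kernelForm, kernelForm, ← Finsupp.sum_add]
  refine Finsupp.sum_congr fun x _ => Finsupp.sum_add_index' (by simp) fun y a b => ?_
  simp [mul_add]

lemma kernelForm_smul_right (c : ℂ) (f g : X →₀ A) :
    kernelForm k f (c • g) = c * kernelForm k f g := by
  rw [kernelForm, kernelForm, Finsupp.mul_sum]
  refine Finsupp.sum_congr fun x _ => ?_
  rw [Finsupp.sum_smul_index' (by simp), Finsupp.mul_sum]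
  simp

lemma kernelForm_smul_left (c : ℂ) (f g : X →₀ A) :
    kernelForm k (c • f) g = starRingEnd ℂ c * kernelForm k f g := by
  rw [kernelForm, kernelForm, Finsupp.sum_smul_index' (by simp), Finsupp.mul_sum]
  refine Finsupp.sum_congr fun x _ => ?_
  rw [Finsupp.mul_sum]
  simp

lemma kernelForm_single_single (x y : X) (a b : A) :
    kernelForm k (Finsupp.single x a) (Finsupp.single y b) = k x y (star a * b) := by
  simp [kernelForm]

/-- A positive kernel has a hermitian form, by polarization. -/
lemma IsPosKernel.conj_symm (hk : IsPosKernel k) (f g : X →₀ A) :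
    starRingEnd ℂ (kernelForm k g f) = kernelForm k f g := by
  have im0 : ∀ h, (kernelForm k h h).im = 0 := fun h => (Complex.nonneg_iff.1 (hk h)).2.symm
  have h1 := im0 (f + g)
  have h2 := im0 (f + Complex.I • g)
  simp only [kernelForm_add_left, kernelForm_add_right, kernelForm_smul_left,
    kernelForm_smul_right, Complex.add_im, Complex.mul_im, Complex.mul_re, Complex.conj_I,
    Complex.neg_re, Complex.neg_im, Complex.I_re, Complex.I_im, Complex.add_re, im0] at h1 h2
  apply Complex.ext <;> simp <;> linarith

/-- The space of finitely supported functions `X → A`, with the semi-inner product of `k`. -/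
def PreKernelSpace (_hk : IsPosKernel k) : Type _ := X →₀ A

variable (hk : IsPosKernel k)

instance : AddCommGroup (PreKernelSpace hk) := inferInstanceAs (AddCommGroup (X →₀ A))
instance : Module ℂ (PreKernelSpace hk) := inferInstanceAs (Module ℂ (X →₀ A))

/-- The identification of finitely supported functions with elements of `PreKernelSpace hk`. -/
def toPreKernel : (X →₀ A) ≃ₗ[ℂ] PreKernelSpace hk := LinearEquiv.refl ℂ _

/-- The semi-inner product given by a positive kernel. -/
abbrev preKernelCore : PreInnerProductSpace.Core ℂ (PreKernelSpace hk) where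
  inner f g := kernelForm k ((toPreKernel hk).symm f) ((toPreKernel hk).symm g)
  conj_inner_symm f g := hk.conj_symm _ _
  re_inner_nonneg f := (Complex.nonneg_iff.1 (hk _)).1
  add_left f g h := by rw [map_add, kernelForm_add_left]
  smul_left f g c := by rw [map_smul, kernelForm_smul_left]

instance : SeminormedAddCommGroup (PreKernelSpace hk) :=
  InnerProductSpace.Core.toSeminormedAddCommGroup (c := preKernelCore hk)
instance : InnerProductSpace ℂ (PreKernelSpace hk) :=
  InnerProductSpace.ofCore (preKernelCore hk)

lemma inner_toPreKernel (f g : X →₀ A) :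
    ⟪toPreKernel hk f, toPreKernel hk g⟫_ℂ = kernelForm k f g := rfl

/-- Pointwise left multiplication by `a` on finitely supported functions. -/
def preLeftMul (a : A) : PreKernelSpace hk →ₗ[ℂ] PreKernelSpace hk :=
  (toPreKernel hk).toLinearMap ∘ₗ Finsupp.mapRange.linearMap (LinearMap.mulLeft ℂ a) ∘ₗ
    (toPreKernel hk).symm.toLinearMap

lemma preLeftMul_toPreKernel (a : A) (f : X →₀ A) :
    preLeftMul hk a (toPreKernel hk f) =
      toPreKernel hk (Finsupp.mapRange (a * ·) (mul_zero a) f) := rfl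

lemma inner_preLeftMul_right (a : A) (f g : PreKernelSpace hk) :
    ⟪f, preLeftMul hk a g⟫_ℂ = ⟪preLeftMul hk (star a) f, g⟫_ℂ := by
  obtain ⟨f, rfl⟩ := (toPreKernel hk).surjective f
  obtain ⟨g, rfl⟩ := (toPreKernel hk).surjective g
  rw [preLeftMul_toPreKernel, preLeftMul_toPreKernel, inner_toPreKernel, inner_toPreKernel,
    kernelForm, kernelForm, Finsupp.sum_mapRange_index (by simp)]
  refine Finsupp.sum_congr fun x _ => ?_
  rw [Finsupp.sum_mapRange_index (by simp)]
  simp [mul_assoc]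

lemma preLeftMul_mul (a b : A) : preLeftMul hk (a * b) = preLeftMul hk a ∘ₗ preLeftMul hk b := by
  refine LinearMap.ext fun f => Finsupp.ext fun x => ?_
  exact mul_assoc a b _

lemma preLeftMul_add (a b : A) : preLeftMul hk (a + b) = preLeftMul hk a + preLeftMul hk b := by
  refine LinearMap.ext fun f => Finsupp.ext fun x => ?_
  exact add_mul a b _

lemma preLeftMul_smul (c : ℂ) (a : A) : preLeftMul hk (c • a) = c • preLeftMul hk a := by
  refine LinearMap.ext fun f => Finsupp.ext fun x => ?_
  exact smul_mul_assoc c a _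

lemma preLeftMul_one : preLeftMul hk (1 : A) = LinearMap.id := by
  refine LinearMap.ext fun f => Finsupp.ext fun x => ?_
  exact one_mul _

lemma exists_norm_sq_sub_eq_star_mul_self (a : A) :
    ∃ b : A, ((‖a‖ ^ 2 : ℝ) : ℂ) • (1 : A) - star a * a = star b * b := by
  let := CStarAlgebra.spectralOrder A
  let := CStarAlgebra.spectralOrderedRing A
  rw [← CStarAlgebra.nonneg_iff_eq_star_mul_self, sub_nonneg]
  have h := IsSelfAdjoint.le_algebraMap_norm_self (IsSelfAdjoint.star_mul_self a)
  rw [CStarRing.norm_star_mul_self, ← sq, Algebra.algebraMap_eq_smul_one] at h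
  exact_mod_cast h

/-- Left multiplication by `a` has norm at most `‖a‖`, because `‖a‖² - a* a = b* b` for some `b`. -/
lemma norm_preLeftMul_le (a : A) (f : PreKernelSpace hk) : ‖preLeftMul hk a f‖ ≤ ‖a‖ * ‖f‖ := by
  obtain ⟨b, hb⟩ := exists_norm_sq_sub_eq_star_mul_self a
  have h1 : ∀ c : A, ‖preLeftMul hk c f‖ ^ 2 = (⟪f, preLeftMul hk (star c * c) f⟫_ℂ).re := by
    intro c
    rw [preLeftMul_mul, LinearMap.comp_apply, inner_preLeftMul_right, star_star,
      ← inner_self_eq_norm_sq (𝕜 := ℂ)]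
    rfl
  have h2 : 0 ≤ ‖preLeftMul hk b f‖ ^ 2 := sq_nonneg _
  have h3 : preLeftMul hk (star b * b) =
      ((‖a‖ ^ 2 : ℝ) : ℂ) • LinearMap.id - preLeftMul hk (star a * a) := by
    rw [← preLeftMul_one, ← preLeftMul_smul, ← hb, eq_sub_iff_add_eq, ← preLeftMul_add,
      sub_add_cancel]
  rw [h1, h3, LinearMap.sub_apply, inner_sub_right, Complex.sub_re, ← h1, LinearMap.smul_apply,
    inner_smul_right, Complex.re_ofReal_mul, LinearMap.id_apply] at h2
  have h4 : (⟪f, f⟫_ℂ).re = ‖f‖ ^ 2 := inner_self_eq_norm_sq (𝕜 := ℂ) f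
  rw [h4] at h2
  refine (sq_le_sq₀ (norm_nonneg _) (by positivity)).1 ?_
  rw [mul_pow]
  linarith

/-- Left multiplication by `a` as a bounded operator. -/
def preLeftMulL (a : A) : PreKernelSpace hk →L[ℂ] PreKernelSpace hk :=
  (preLeftMul hk a).mkContinuous ‖a‖ (norm_preLeftMul_le hk a)

lemma preLeftMulL_apply (a : A) (f : PreKernelSpace hk) :
    preLeftMulL hk a f = preLeftMul hk a f := rfl

/-- The representation of `A` by left multiplication on the completion of `PreKernelSpace hk`. The
completion also divides out the null vectors of the semi-inner product. -/
def kernelRep : HilbertRep.{u, max u v} A where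
  K := Completion (PreKernelSpace hk)
  π :=
  { toFun a := (preLeftMulL hk a).completion
    map_one' := by
      ext f
      induction f using Completion.induction_on with
      | hp => apply isClosed_eq <;> fun_prop
      | ih f => simp [preLeftMulL_apply, preLeftMul_one]
    map_mul' a b := by
      ext f
      induction f using Completion.induction_on with
      | hp => apply isClosed_eq <;> fun_prop
      | ih f => simp [preLeftMulL_apply, preLeftMul_mul]
    map_zero' := by
      ext f
      induction f using Completion.induction_on with
      | hp => apply isClosed_eq <;> fun_prop
      | ih f =>
        have : preLeftMul hk (0 : A) = 0 := by simpa using preLeftMul_smul hk 0 0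
        simpa [preLeftMulL_apply, this] using Completion.coe_zero
    map_add' a b := by
      ext f
      induction f using Completion.induction_on with
      | hp => apply isClosed_eq <;> fun_prop
      | ih f => simp [preLeftMulL_apply, preLeftMul_add, Completion.coe_add]
    commutes' c := by
      ext f
      induction f using Completion.induction_on with
      | hp => apply isClosed_eq <;> fun_prop
      | ih f =>
        simp [preLeftMulL_apply, preLeftMul_smul, preLeftMul_one, Algebra.algebraMap_eq_smul_one,
          Completion.coe_smul]
    map_star' a := by
      refine (ContinuousLinearMap.eq_adjoint_iff _ _).2 fun f g => ?_
      induction f, g using Completion.induction_on₂ with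
      | hp => apply isClosed_eq <;> fun_prop
      | ih f g =>
        simp only [ContinuousLinearMap.completion_apply_coe, Completion.inner_coe,
          preLeftMulL_apply]
        rw [inner_preLeftMul_right] }

/-- The canonical map of `X` into the space of `kernelRep hk`. -/
def kernelVec (x : X) : (kernelRep hk).K :=
  (toPreKernel hk (Finsupp.single x (1 : A)) : Completion (PreKernelSpace hk))

lemma kernelRep_π_coe (a : A) (f : PreKernelSpace hk) :
    (kernelRep hk).π a (f : Completion (PreKernelSpace hk)) =
      ((preLeftMul hk a f : PreKernelSpace hk) : Completion (PreKernelSpace hk)) :=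
  ContinuousLinearMap.completion_apply_coe _ _

/-- The kernel is recovered from the representation as `k(x, y)(a) = ⟨x, π(a) y⟩`. -/
lemma inner_kernelVec (x y : X) (a : A) :
    ⟪kernelVec hk x, (kernelRep hk).π a (kernelVec hk y)⟫_ℂ = k x y a := by
  rw [kernelVec, kernelVec, kernelRep_π_coe, preLeftMul_toPreKernel, Finsupp.mapRange_single]
  refine (Completion.inner_coe _ _).trans ?_
  rw [inner_toPreKernel, kernelForm_single_single]
  simp

/-- Kolmogorov decomposition of a positive kernel. -/
lemma exists_kernelRep (hk : IsPosKernel k) : ∃ (r : HilbertRep.{u, max u v} A) (V : X → r.K),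
    ∀ x y a, ⟪V x, r.π a (V y)⟫_ℂ = k x y a :=
  ⟨kernelRep hk, kernelVec hk, inner_kernelVec hk⟩

lemma HilbertRep.inner_π_star {r : HilbertRep.{u, w} A} (a : A) (x y : r.K) :
    ⟪r.π a x, y⟫_ℂ = ⟪x, r.π (star a) y⟫_ℂ := by
  rw [map_star, ContinuousLinearMap.star_eq_adjoint, ContinuousLinearMap.adjoint_inner_right]

/-- Minimality of `kernelRep`: it embeds, compatibly with the actions of `A`, into every
representation that carries vectors realizing the same kernel. -/
lemma exists_isometric_intertwiner (r : HilbertRep.{u, w} A) (W : X → r.K)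
    (hW : ∀ x y a, ⟪W x, r.π a (W y)⟫_ℂ = k x y a) :
    ∃ T : (kernelRep hk).K →L[ℂ] r.K, (∀ ξ, ‖T ξ‖ = ‖ξ‖) ∧ (∀ x, T (kernelVec hk x) = W x) ∧
      ∀ a ξ, T ((kernelRep hk).π a ξ) = r.π a (T ξ) := by
  let T₀ : PreKernelSpace hk →ₗ[ℂ] r.K :=
    (Finsupp.lsum ℂ fun x => LinearMap.applyₗ (W x) ∘ₗ ContinuousLinearMap.coeLM ℂ ∘ₗ
      (r.π : A →ₗ[ℂ] (r.K →L[ℂ] r.K))) ∘ₗ (toPreKernel hk).symm.toLinearMap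
  have hT₀ : ∀ f : X →₀ A, T₀ (toPreKernel hk f) = f.sum fun x a => r.π a (W x) := fun f => rfl
  have hinner : ∀ f g : PreKernelSpace hk, ⟪T₀ f, T₀ g⟫_ℂ = ⟪f, g⟫_ℂ := by
    intro f g
    obtain ⟨f, rfl⟩ := (toPreKernel hk).surjective f
    obtain ⟨g, rfl⟩ := (toPreKernel hk).surjective g
    rw [inner_toPreKernel, hT₀, hT₀, kernelForm, Finsupp.sum, sum_inner]
    refine Finset.sum_congr rfl fun x _ => ?_
    rw [Finsupp.sum, inner_sum]
    refine Finset.sum_congr rfl fun y _ => ?_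
    rw [HilbertRep.inner_π_star, ← mul_apply_eq_comp, ← map_mul, hW]
  have hnorm : ∀ f : PreKernelSpace hk, ‖T₀ f‖ = ‖f‖ := fun f => by
    rw [norm_eq_sqrt_re_inner (𝕜 := ℂ), hinner, ← norm_eq_sqrt_re_inner (𝕜 := ℂ)]
  let T₁ : PreKernelSpace hk →L[ℂ] r.K := T₀.mkContinuous 1 fun f => by rw [hnorm, one_mul]
  have hT₁ : ∀ f : PreKernelSpace hk,
      T₁.fromCompletion (f : Completion (PreKernelSpace hk)) = T₀ f := fun f =>
    ContinuousLinearMap.fromCompletion_apply_coe _ _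
  refine ⟨T₁.fromCompletion, fun ξ => ?_, fun x => ?_, fun a ξ => ?_⟩
  · induction ξ using Completion.induction_on with
    | hp => apply isClosed_eq <;> fun_prop
    | ih f => exact (congrArg norm (hT₁ f)).trans ((hnorm f).trans (Completion.norm_coe f).symm)
  · refine (hT₁ _).trans ?_
    rw [hT₀]
    simp
  · induction ξ using Completion.induction_on with
    | hp => apply isClosed_eq <;> fun_prop
    | ih f =>
      obtain ⟨f, rfl⟩ := (toPreKernel hk).surjective f
      rw [kernelRep_π_coe]
      refine (hT₁ _).trans ((?_ : _ = r.π a (T₀ (toPreKernel hk f))).trans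
        (congrArg (r.π a) (hT₁ f)).symm)
      rw [hT₀, preLeftMul_toPreKernel, hT₀, Finsupp.sum_mapRange_index (by simp), Finsupp.sum,
        Finsupp.sum, map_sum]
      simp

end Kernel

section Sums

variable {A : Type u} [CStarAlgebra A]

/-- The block-diagonal sum of a family of kernels: it vanishes between different summands. -/
def sigmaKernel {ι : Type w} {X : ι → Type v} (k : ∀ i, X i → X i → A →ₗ[ℂ] ℂ)
    (p q : Σ i, X i) : A →ₗ[ℂ] ℂ :=
  open Classical in if h : q.1 = p.1 then k p.1 p.2 (h ▸ q.2) else 0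

lemma sigmaKernel_self {ι : Type w} {X : ι → Type v} (k : ∀ i, X i → X i → A →ₗ[ℂ] ℂ) (i : ι)
    (x y : X i) : sigmaKernel k ⟨i, x⟩ ⟨i, y⟩ = k i x y := by
  simp [sigmaKernel]

lemma isPosKernel_sigmaKernel {ι : Type w} {X : ι → Type v} {k : ∀ i, X i → X i → A →ₗ[ℂ] ℂ}
    (hk : ∀ i, IsPosKernel (k i)) : IsPosKernel (sigmaKernel k) := by
  classical
  intro f
  have key : kernelForm (sigmaKernel k) f f =
      ∑ i ∈ f.support.image Sigma.fst, kernelForm (k i) (f.split i) (f.split i) := by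
    have h1 : ∀ (F : (Σ i, X i) → ℂ), ∑ p ∈ f.support, F p =
        ∑ i ∈ f.support.image Sigma.fst, ∑ x ∈ (f.split i).support, F ⟨i, x⟩ := by
      intro F
      rw [← Finset.sum_fiberwise_of_maps_to (g := Sigma.fst) (t := f.support.image Sigma.fst)
        (fun p hp => Finset.mem_image_of_mem _ hp)]
      refine Finset.sum_congr rfl fun i _ => ?_
      refine (Finset.sum_bij (fun x _ => (⟨i, x⟩ : Σ i, X i)) ?_ ?_ ?_ ?_).symm
      · intro x hx
        simpa [Finsupp.split_apply] using hx
      · intro x _ y _ h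
        simpa using h
      · rintro ⟨j, y⟩ hj
        simp only [Finset.mem_filter] at hj
        obtain ⟨hj, rfl⟩ := hj
        exact ⟨y, by simpa [Finsupp.split_apply] using hj, rfl⟩
      · intro x _
        rfl
    rw [kernelForm, Finsupp.sum, h1]
    refine Finset.sum_congr rfl fun i hi => ?_
    rw [kernelForm, Finsupp.sum]
    refine Finset.sum_congr rfl fun x _ => ?_
    rw [Finsupp.sum, h1, Finset.sum_eq_single_of_mem i hi]
    · simp [Finsupp.sum, sigmaKernel_self, Finsupp.split_apply]
    · intro j _ hj
      refine Finset.sum_eq_zero fun y _ => ?_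
      simp [sigmaKernel, hj]
  rw [key]
  exact Finset.sum_nonneg fun i _ => hk i _

/-- A map between Hilbert spaces whose Gram kernel is `⟨x, G y⟩` is linear and bounded. -/
lemma exists_clm_of_inner {E : Type v} [NormedAddCommGroup E] [InnerProductSpace ℂ E] {K : Type w}
    [NormedAddCommGroup K] [InnerProductSpace ℂ K] (V : E → K) (G : E →L[ℂ] E)
    (h : ∀ x y, ⟪V x, V y⟫_ℂ = ⟪x, G y⟫_ℂ) : ∃ V' : E →L[ℂ] K, ∀ x, V' x = V x := by
  let V₀ : E →ₗ[ℂ] K :=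
    { toFun := V
      map_add' := fun x y => by
        have h0 : ∀ z, ⟪V z, V (x + y) - (V x + V y)⟫_ℂ = 0 := fun z => by
          rw [inner_sub_right, inner_add_right]
          simp only [h, map_add, inner_add_right, sub_self]
        have : ⟪V (x + y) - (V x + V y), V (x + y) - (V x + V y)⟫_ℂ = 0 := by
          nth_rewrite 1 [inner_sub_left]
          rw [inner_add_left, h0, h0, h0]
          simp
        exact sub_eq_zero.1 (inner_self_eq_zero.1 this)
      map_smul' := fun c x => by
        have h0 : ∀ z, ⟪V z, V (c • x) - c • V x⟫_ℂ = 0 := fun z => by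
          rw [inner_sub_right, inner_smul_right]
          simp only [h, map_smul, inner_smul_right, sub_self]
        have : ⟪V (c • x) - c • V x, V (c • x) - c • V x⟫_ℂ = 0 := by
          nth_rewrite 1 [inner_sub_left]
          rw [inner_smul_left, h0, h0]
          simp
        exact sub_eq_zero.1 (inner_self_eq_zero.1 this) }
  refine ⟨V₀.mkContinuous (√‖G‖) fun x => ?_, fun x => rfl⟩
  change ‖V x‖ ≤ _
  refine (sq_le_sq₀ (norm_nonneg _) (by positivity)).1 ?_
  rw [mul_pow, Real.sq_sqrt (norm_nonneg _), ← inner_self_eq_norm_sq (𝕜 := ℂ), h]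
  calc RCLike.re ⟪x, G x⟫_ℂ ≤ ‖⟪x, G x⟫_ℂ‖ := RCLike.re_le_norm _
    _ ≤ ‖x‖ * ‖G x‖ := norm_inner_le_norm _ _
    _ ≤ ‖x‖ * (‖G‖ * ‖x‖) := by gcongr; exact G.le_opNorm x
    _ = ‖G‖ * ‖x‖ ^ 2 := by ring

end Sums

/-! ### The Bures metric on completely positive maps -/

section Bures

lemma inner_self_eq_ofReal_norm_sq {E : Type*} [SeminormedAddCommGroup E] [InnerProductSpace ℂ E]
    (x : E) : ⟪x, x⟫_ℂ = ((‖x‖ ^ 2 : ℝ) : ℂ) := by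
  rw [inner_self_eq_norm_sq_to_K, Complex.ofReal_pow]
  rfl

variable {A : Type u} [CStarAlgebra A]
variable {H : Type v} [NormedAddCommGroup H] [InnerProductSpace ℂ H]

/-- The kernel `(h, h') ↦ ⟨h, φ(·) h'⟩` of a linear map `φ : A → B(H)`. -/
def mapKernel (φ : A →ₗ[ℂ] (H →L[ℂ] H)) (h h' : H) : A →ₗ[ℂ] ℂ where
  toFun a := ⟪h, φ a h'⟫_ℂ
  map_add' a b := by simp
  map_smul' c a := by simp

lemma mapKernel_apply (φ : A →ₗ[ℂ] (H →L[ℂ] H)) (h h' : H) (a : A) :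
    mapKernel φ h h' a = ⟪h, φ a h'⟫_ℂ := rfl

/-- The kernel `(x, y) ↦ ⟨w x, π(·) (w y)⟩` of a family of vectors in a representation. -/
def vectorKernel {X : Type*} (r : HilbertRep.{u, w} A) (w : X → r.K) (x y : X) : A →ₗ[ℂ] ℂ :=
  mapKernel (r.π : A →ₗ[ℂ] (r.K →L[ℂ] r.K)) (w x) (w y)

lemma kernelForm_vectorKernel {X : Type*} (r : HilbertRep.{u, w} A) (w : X → r.K) (f : X →₀ A) :
    kernelForm (vectorKernel r w) f f =
      ⟪f.sum fun x a => r.π a (w x), f.sum fun x a => r.π a (w x)⟫_ℂ := by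
  rw [kernelForm, Finsupp.sum, Finsupp.sum, sum_inner]
  refine Finset.sum_congr rfl fun x _ => ?_
  rw [Finsupp.sum, inner_sum]
  refine Finset.sum_congr rfl fun y _ => ?_
  rw [HilbertRep.inner_π_star, ← mul_apply_eq_comp, ← map_mul]
  rfl

/-- If `U` is a contraction `K₂ → K₁` that intertwines two representations, then `K₁` and `K₂` embed
in a third representation so that the inner product of a vector `x` of `K₁` with a vector `y` of
`K₂` is `⟨x, U y⟩`. -/
lemma exists_amalgam (r₁ r₂ : HilbertRep.{u, w} A) (U : r₂.K →L[ℂ] r₁.K) (hU : ∀ y, ‖U y‖ ≤ ‖y‖)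
    (hUπ : ∀ a y, U (r₂.π a y) = r₁.π a (U y)) :
    ∃ (r : HilbertRep.{u, max u w} A) (J₁ : r₁.K →L[ℂ] r.K) (J₂ : r₂.K →L[ℂ] r.K),
      (∀ x x' a, ⟪J₁ x, r.π a (J₁ x')⟫_ℂ = ⟪x, r₁.π a x'⟫_ℂ) ∧
      (∀ y y' a, ⟪J₂ y, r.π a (J₂ y')⟫_ℂ = ⟪y, r₂.π a y'⟫_ℂ) ∧
      ∀ x y, ⟪J₁ x, J₂ y⟫_ℂ = ⟪x, U y⟫_ℂ := by
  let w₁ : r₁.K ⊕ r₂.K → r₁.K := Sum.elim id U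
  let w₂ : r₁.K ⊕ r₂.K → r₂.K := Sum.elim 0 id
  let k : r₁.K ⊕ r₂.K → r₁.K ⊕ r₂.K → A →ₗ[ℂ] ℂ := fun p q =>
    vectorKernel r₁ w₁ p q + vectorKernel r₂ w₂ p q - vectorKernel r₁ (U ∘ w₂) p q
  -- On finitely supported functions the form is `‖ξ₁‖² + ‖ξ₂‖² - ‖U ξ₂‖²`.
  have hk : IsPosKernel k := by
    intro f
    have h1 : kernelForm k f f = kernelForm (vectorKernel r₁ w₁) f f +
        kernelForm (vectorKernel r₂ w₂) f f - kernelForm (vectorKernel r₁ (U ∘ w₂)) f f := by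
      simp only [kernelForm, Finsupp.sum, ← Finset.sum_add_distrib, ← Finset.sum_sub_distrib]
      rfl
    have h2 : (f.sum fun x a => r₁.π a ((U ∘ w₂) x)) = U (f.sum fun x a => r₂.π a (w₂ x)) := by
      rw [Finsupp.sum, Finsupp.sum, map_sum]
      exact Finset.sum_congr rfl fun x _ => (hUπ _ _).symm
    rw [h1, kernelForm_vectorKernel, kernelForm_vectorKernel, kernelForm_vectorKernel, h2]
    simp only [inner_self_eq_ofReal_norm_sq]
    set ξ₁ := f.sum fun x a => r₁.π a (w₁ x)
    set ξ₂ := f.sum fun x a => r₂.π a (w₂ x)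
    have h3 : ‖U ξ₂‖ ^ 2 ≤ ‖ξ₂‖ ^ 2 := by gcongr; exact hU ξ₂
    have h4 : 0 ≤ ‖ξ₁‖ ^ 2 + ‖ξ₂‖ ^ 2 - ‖U ξ₂‖ ^ 2 := by nlinarith [sq_nonneg ‖ξ₁‖]
    exact_mod_cast Complex.zero_le_real.2 h4
  have hkl : ∀ x x' a, k (.inl x) (.inl x') a = ⟪x, r₁.π a x'⟫_ℂ := fun x x' a => by
    simp [k, w₁, w₂, vectorKernel, mapKernel_apply]
  have hkr : ∀ y y' a, k (.inr y) (.inr y') a = ⟪y, r₂.π a y'⟫_ℂ := fun x x' a => by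
    simp [k, w₁, w₂, vectorKernel, mapKernel_apply]
  have hklr : ∀ x y a, k (.inl x) (.inr y) a = ⟪x, r₁.π a (U y)⟫_ℂ := fun x x' a => by
    simp [k, w₁, w₂, vectorKernel, mapKernel_apply]
  have hinner : ∀ p q, ⟪kernelVec hk p, kernelVec hk q⟫_ℂ = k p q 1 := fun p q => by
    rw [← inner_kernelVec hk, map_one, one_apply_eq_self]
  obtain ⟨J₁, hJ₁⟩ := exists_clm_of_inner (fun x : r₁.K => kernelVec hk (.inl x)) 1
    fun x y => by rw [hinner, hkl, map_one]
  obtain ⟨J₂, hJ₂⟩ := exists_clm_of_inner (fun x : r₂.K => kernelVec hk (.inr x)) 1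
    fun x y => by rw [hinner, hkr, map_one]
  refine ⟨kernelRep hk, J₁, J₂, fun x x' a => ?_, fun y y' a => ?_, fun x y => ?_⟩
  · rw [hJ₁, hJ₁, inner_kernelVec, hkl]
  · rw [hJ₂, hJ₂, inner_kernelVec, hkr]
  · rw [hJ₁, hJ₂, hinner, hklr, map_one, one_apply_eq_self]

variable [CompleteSpace H] [PartialOrder A] [StarOrderedRing A]

/-- A positive operator matrix has nonnegative quadratic form. -/
lemma CStarMatrix.sum_inner_nonneg {n : Type*} [Fintype n] {M : CStarMatrix n n (H →L[ℂ] H)}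
    (hM : 0 ≤ M) (h : n → H) : 0 ≤ ∑ i, ∑ j, ⟪h i, M i j (h j)⟫_ℂ := by
  rw [StarOrderedRing.nonneg_iff] at hM
  induction hM using AddSubmonoid.closure_induction with
  | zero => simp
  | add M N _ _ hM hN => simpa [inner_add_right, Finset.sum_add_distrib] using add_nonneg hM hN
  | mem M hM =>
    obtain ⟨Y, rfl⟩ := hM
    have key : ∑ i, ∑ j, ⟪h i, (star Y * Y) i j (h j)⟫_ℂ =
        ∑ l, ⟪∑ i, Y l i (h i), ∑ i, Y l i (h i)⟫_ℂ := by
      simp_rw [sum_inner, inner_sum]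
      rw [Finset.sum_comm]
      refine (Finset.sum_congr rfl fun j _ => Finset.sum_congr rfl fun i _ => ?_).trans
        (Finset.sum_congr rfl fun j _ => Finset.sum_comm) |>.trans Finset.sum_comm |>.trans
        (Finset.sum_congr rfl fun l _ => Finset.sum_comm)
      rw [CStarMatrix.mul_apply, sum_apply, inner_sum]
      refine Finset.sum_congr rfl fun l _ => ?_
      rw [CStarMatrix.star_apply, mul_apply_eq_comp, ContinuousLinearMap.star_eq_adjoint,
        ContinuousLinearMap.adjoint_inner_right]
    change 0 ≤ ∑ i, ∑ j, ⟪h i, (star Y * Y) i j (h j)⟫_ℂ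
    rw [key]
    refine Finset.sum_nonneg fun l _ => ?_
    rw [inner_self_eq_ofReal_norm_sq]
    exact Complex.zero_le_real.2 (sq_nonneg _)

/-- Completely positive maps have positive kernels: `(a_i* a_j)` is a positive matrix over `A`. -/
lemma isPosKernel_of_mem_CPCone {φ : CBMaps A H} (hφ : φ ∈ CPCone A H) :
    IsPosKernel (mapKernel (φ : A →ₗ[ℂ] (H →L[ℂ] H))) := by
  classical
  obtain ⟨Φ, hΦ⟩ := hφ
  intro f
  rcases f.support.eq_empty_or_nonempty with h0 | ⟨i₀, hi₀⟩
  · simp [kernelForm, Finsupp.sum, h0]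
  let R : CStarMatrix f.support f.support A :=
    CStarMatrix.ofMatrix fun i j => if i = ⟨i₀, hi₀⟩ then f j else 0
  have hRa : ∀ i j, R i j = if i = ⟨i₀, hi₀⟩ then f j else 0 := fun _ _ => rfl
  have hR : ∀ i j, (star R * R) i j = star (f i) * f j := fun i j => by
    rw [CStarMatrix.mul_apply, Finset.sum_eq_single ⟨i₀, hi₀⟩]
    · rw [CStarMatrix.star_apply, hRa, hRa, if_pos rfl, if_pos rfl]
    · intro b _ hb
      rw [hRa b j, if_neg hb, mul_zero]
    · simp
  have h := CStarMatrix.sum_inner_nonneg (Φ.map_cstarMatrix_nonneg _ (star_mul_self_nonneg R))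
    (fun i => (i : H))
  simp only [CStarMatrix.map_apply, hR] at h
  rw [kernelForm, Finsupp.sum, ← Finset.sum_coe_sort]
  refine h.trans_eq (Finset.sum_congr rfl fun i _ => ?_)
  rw [Finsupp.sum, ← Finset.sum_coe_sort f.support]
  refine Finset.sum_congr rfl fun j _ => ?_
  rw [mapKernel_apply, ← hΦ]
  rfl

/-- Membership in `𝒮_π(φ)` says that `V` realizes the kernel of `φ`. -/
lemma mem_stinespringSet_iff {r : HilbertRep.{u, w} A} {φ : CBMaps A H} {V : H →L[ℂ] r.K} :
    V ∈ stinespringSet r φ ↔ ∀ (h h' : H) (a : A),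
      ⟪V h, r.π a (V h')⟫_ℂ = ⟪h, (φ : A →ₗ[ℂ] (H →L[ℂ] H)) a h'⟫_ℂ := by
  refine ⟨fun hV h h' a => ?_, fun hV a => ?_⟩
  · rw [hV a]
    simp [ContinuousLinearMap.adjoint_inner_right]
  · ext h'
    refine ext_inner_left ℂ fun h => ?_
    rw [← hV]
    simp [ContinuousLinearMap.adjoint_inner_right]

/-- Two completely positive maps have Stinespring dilations over a common representation. -/
lemma exists_common_stinespring (φ ψ : CPCone A H) : ∃ (r : HilbertRep.{u, max u v} A)
    (V W : H →L[ℂ] r.K), V ∈ stinespringSet r φ.1 ∧ W ∈ stinespringSet r ψ.1 := by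
  let k : ∀ _ : Bool, H → H → A →ₗ[ℂ] ℂ := fun b =>
    mapKernel (bif b then φ.1.1 else ψ.1.1 : A →ₗ[ℂ] (H →L[ℂ] H))
  have hk : ∀ b, IsPosKernel (k b)
    | true => isPosKernel_of_mem_CPCone φ.2
    | false => isPosKernel_of_mem_CPCone ψ.2
  let hs := isPosKernel_sigmaKernel hk
  have hin : ∀ (b : Bool) (h h' : H) (a : A),
      ⟪kernelVec hs ⟨b, h⟩, (kernelRep hs).π a (kernelVec hs ⟨b, h'⟩)⟫_ℂ = k b h h' a := by
    intro b h h' a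
    rw [inner_kernelVec, sigmaKernel_self]
  have hin1 : ∀ (b : Bool) (h h' : H), ⟪kernelVec hs ⟨b, h⟩, kernelVec hs ⟨b, h'⟩⟫_ℂ =
      ⟪h, (bif b then φ.1.1 else ψ.1.1 : A →ₗ[ℂ] (H →L[ℂ] H)) 1 h'⟫_ℂ := by
    intro b h h'
    have := hin b h h' 1
    rwa [map_one, one_apply_eq_self] at this
  obtain ⟨V, hV⟩ := exists_clm_of_inner (fun h => kernelVec hs ⟨true, h⟩) _ (hin1 true)
  obtain ⟨W, hW⟩ := exists_clm_of_inner (fun h => kernelVec hs ⟨false, h⟩) _ (hin1 false)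
  refine ⟨kernelRep hs, V, W, mem_stinespringSet_iff.2 fun h h' a => ?_,
    mem_stinespringSet_iff.2 fun h h' a => ?_⟩
  · rw [hV, hV, hin]; rfl
  · rw [hW, hW, hin]; rfl

/-- The minimal Stinespring dilation. -/
lemma exists_minimal_stinespring {ψ : CBMaps A H} (hψ : ψ ∈ CPCone A H) :
    ∃ (r₀ : HilbertRep.{u, max u v} A) (V₀ : H → r₀.K),
      ∀ (r : HilbertRep.{u, max u v} A), ∀ W ∈ stinespringSet r ψ,
        ∃ T : r₀.K →L[ℂ] r.K, (∀ ξ, ‖T ξ‖ = ‖ξ‖) ∧ (∀ h, T (V₀ h) = W h) ∧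
          ∀ a ξ, T (r₀.π a ξ) = r.π a (T ξ) :=
  ⟨kernelRep (isPosKernel_of_mem_CPCone hψ), kernelVec _, fun r W hW =>
    exists_isometric_intertwiner _ r W fun x y a => mem_stinespringSet_iff.1 hW x y a⟩

/-- Two representations containing dilations `W₁`, `W₂` of the same completely positive map can be
amalgamated along them: they embed in a common representation in which `W₁` and `W₂` coincide. The
partial isometry between the subspaces spanned by `W₁` and `W₂` is `T₁ T₂*`, where `T₁` and `T₂`
embed the minimal dilation. -/
lemma exists_amalgam_stinespring {ψ : CBMaps A H} (hψ : ψ ∈ CPCone A H)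
    (r₁ r₂ : HilbertRep.{u, max u v} A) {W₁ : H →L[ℂ] r₁.K} {W₂ : H →L[ℂ] r₂.K}
    (hW₁ : W₁ ∈ stinespringSet r₁ ψ) (hW₂ : W₂ ∈ stinespringSet r₂ ψ) :
    ∃ (r : HilbertRep.{u, max u v} A) (J₁ : r₁.K →L[ℂ] r.K) (J₂ : r₂.K →L[ℂ] r.K),
      (∀ x x' a, ⟪J₁ x, r.π a (J₁ x')⟫_ℂ = ⟪x, r₁.π a x'⟫_ℂ) ∧
      (∀ y y' a, ⟪J₂ y, r.π a (J₂ y')⟫_ℂ = ⟪y, r₂.π a y'⟫_ℂ) ∧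
      ∀ h, J₁ (W₁ h) = J₂ (W₂ h) := by
  obtain ⟨r₀, V₀, hr₀⟩ := exists_minimal_stinespring hψ
  obtain ⟨T₁, hT₁, hTW₁, hTπ₁⟩ := hr₀ r₁ W₁ hW₁
  obtain ⟨T₂, hT₂, hTW₂, hTπ₂⟩ := hr₀ r₂ W₂ hW₂
  have hT₂T₂ := (T₂.norm_map_iff_adjoint_comp_self).1 hT₂
  have hT₂T₂' : ∀ ξ, T₂.adjoint (T₂ ξ) = ξ := fun ξ => DFunLike.congr_fun hT₂T₂ ξ
  let U : r₂.K →L[ℂ] r₁.K := T₁ ∘L T₂.adjoint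
  have hU : ∀ y, ‖U y‖ ≤ ‖y‖ := fun y => by
    have h1 : ‖T₂.adjoint‖ ≤ 1 := by
      rw [LinearIsometryEquiv.norm_map]
      exact T₂.opNorm_le_bound zero_le_one fun ξ => by rw [hT₂, one_mul]
    calc ‖U y‖ = ‖T₂.adjoint y‖ := hT₁ _
      _ ≤ 1 * ‖y‖ := T₂.adjoint.le_of_opNorm_le h1 y
      _ = ‖y‖ := one_mul _
  have hUπ : ∀ a y, U (r₂.π a y) = r₁.π a (U y) := fun a y => by
    change T₁ (T₂.adjoint (r₂.π a y)) = r₁.π a (T₁ (T₂.adjoint y))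
    rw [← hTπ₁]
    congr 1
    refine ext_inner_left ℂ fun ξ => ?_
    rw [ContinuousLinearMap.adjoint_inner_right, ← star_star a, ← HilbertRep.inner_π_star,
      ← HilbertRep.inner_π_star, ContinuousLinearMap.adjoint_inner_right, hTπ₂]
  obtain ⟨r, J₁, J₂, h11, h22, h12⟩ := exists_amalgam r₁ r₂ U hU hUπ
  refine ⟨r, J₁, J₂, h11, h22, fun h => ?_⟩
  have h11' : ∀ x x', ⟪J₁ x, J₁ x'⟫_ℂ = ⟪x, x'⟫_ℂ := fun x x' => by
    simpa using h11 x x' 1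
  have h22' : ∀ x x', ⟪J₂ x, J₂ x'⟫_ℂ = ⟪x, x'⟫_ℂ := fun x x' => by
    simpa using h22 x x' 1
  have hUW : U (W₂ h) = W₁ h := by
    change T₁ (T₂.adjoint (W₂ h)) = W₁ h
    rw [← hTW₂, hT₂T₂', hTW₁]
  have hWW : ⟪W₁ h, W₁ h⟫_ℂ = ⟪W₂ h, W₂ h⟫_ℂ := by
    have h1 := mem_stinespringSet_iff.1 hW₁ h h 1
    rw [← mem_stinespringSet_iff.1 hW₂ h h 1] at h1
    simpa using h1
  rw [← sub_eq_zero, ← inner_self_eq_zero (𝕜 := ℂ), inner_sub_left, inner_sub_right,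
    inner_sub_right, h11', h22', ← inner_conj_symm (J₂ _), h12, hUW, inner_conj_symm, hWW]
  ring

/-- The Bures distance with values in `[0, ∞]`. -/
def eBures (φ ψ : CBMaps A H) : ℝ≥0∞ := ⨅ r : HilbertRep.{u, max u v} A, buresRep r φ ψ

lemma bures_eq_toReal (φ ψ : CPCone A H) : bures φ ψ = (eBures φ.1 ψ.1).toReal := rfl

lemma eBures_lt_iff {φ ψ : CBMaps A H} {c : ℝ≥0∞} : eBures φ ψ < c ↔
    ∃ (r : HilbertRep.{u, max u v} A) (V W : H →L[ℂ] r.K), V ∈ stinespringSet r φ ∧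
      W ∈ stinespringSet r ψ ∧ ENNReal.ofReal ‖V - W‖ < c := by
  simp only [eBures, buresRep, iInf_lt_iff]
  constructor
  · rintro ⟨r, V, hV, W, hW, h⟩
    exact ⟨r, V, W, hV, hW, h⟩
  · rintro ⟨r, V, W, hV, hW, h⟩
    exact ⟨r, V, hV, W, hW, h⟩

lemma eBures_ne_top (φ ψ : CPCone A H) : eBures φ.1 ψ.1 ≠ ∞ := by
  obtain ⟨r, V, W, hV, hW⟩ := exists_common_stinespring φ ψ
  exact (eBures_lt_iff.2 ⟨r, V, W, hV, hW, ENNReal.ofReal_lt_top⟩).ne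

lemma eBures_comm (φ ψ : CBMaps A H) : eBures φ ψ = eBures ψ φ := by
  have h : ∀ φ ψ : CBMaps A H, eBures φ ψ ≤ eBures ψ φ := fun φ ψ =>
    le_of_forall_gt fun c hc => by
      obtain ⟨r, V, W, hV, hW, h⟩ := eBures_lt_iff.1 hc
      exact eBures_lt_iff.2 ⟨r, W, V, hW, hV, by rwa [norm_sub_rev]⟩
  exact le_antisymm (h _ _) (h _ _)

lemma eBures_self (φ : CPCone A H) : eBures φ.1 φ.1 = 0 := by
  obtain ⟨r, V, _, hV, _⟩ := exists_common_stinespring φ φ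
  refine nonpos_iff_eq_zero.1 (le_of_forall_gt fun c hc => ?_)
  exact eBures_lt_iff.2 ⟨r, V, V, hV, hV, by simpa using hc⟩

lemma eBures_triangle (φ ψ χ : CPCone A H) :
    eBures φ.1 χ.1 ≤ eBures φ.1 ψ.1 + eBures ψ.1 χ.1 := by
  refine ENNReal.le_of_forall_pos_le_add fun ε hε _ => ?_
  have hε2 : (ε / 2 : ℝ≥0∞) ≠ 0 := by simpa using hε.ne'
  obtain ⟨r₁, V, W₁, hV, hW₁, h₁⟩ := eBures_lt_iff.1 (ENNReal.lt_add_right (eBures_ne_top φ ψ) hε2)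
  obtain ⟨r₂, W₂, X, hW₂, hX, h₂⟩ := eBures_lt_iff.1 (ENNReal.lt_add_right (eBures_ne_top ψ χ) hε2)
  obtain ⟨r, J₁, J₂, h11, h22, h12⟩ := exists_amalgam_stinespring ψ.2 r₁ r₂ hW₁ hW₂
  have hn₁ : ∀ x, ‖J₁ x‖ = ‖x‖ := fun x => by
    rw [norm_eq_sqrt_re_inner (𝕜 := ℂ), norm_eq_sqrt_re_inner (𝕜 := ℂ)]
    have := h11 x x 1
    simp only [map_one, one_apply_eq_self] at this
    rw [this]
  have hn₂ : ∀ x, ‖J₂ x‖ = ‖x‖ := fun x => by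
    rw [norm_eq_sqrt_re_inner (𝕜 := ℂ), norm_eq_sqrt_re_inner (𝕜 := ℂ)]
    have := h22 x x 1
    simp only [map_one, one_apply_eq_self] at this
    rw [this]
  have hd : ‖J₁ ∘L V - J₂ ∘L X‖ ≤ ‖V - W₁‖ + ‖W₂ - X‖ := by
    refine ContinuousLinearMap.opNorm_le_bound _ (by positivity) fun h => ?_
    have : (J₁ ∘L V - J₂ ∘L X) h = J₁ ((V - W₁) h) + J₂ ((W₂ - X) h) := by
      simp [h12]
    rw [this, add_mul]
    refine (norm_add_le _ _).trans ?_
    rw [hn₁, hn₂]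
    exact add_le_add (ContinuousLinearMap.le_opNorm _ _) (ContinuousLinearMap.le_opNorm _ _)
  have hlt : eBures φ.1 χ.1 < eBures φ.1 ψ.1 + ε / 2 + (eBures ψ.1 χ.1 + ε / 2) := by
    refine eBures_lt_iff.2 ⟨r, J₁ ∘L V, J₂ ∘L X, ?_, ?_, ?_⟩
    · refine mem_stinespringSet_iff.2 fun h h' a => ?_
      exact (h11 _ _ _).trans (mem_stinespringSet_iff.1 hV h h' a)
    · refine mem_stinespringSet_iff.2 fun h h' a => ?_
      exact (h22 _ _ _).trans (mem_stinespringSet_iff.1 hX h h' a)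
    · refine lt_of_le_of_lt (ENNReal.ofReal_le_ofReal hd) ?_
      rw [ENNReal.ofReal_add (norm_nonneg _) (norm_nonneg _)]
      exact ENNReal.add_lt_add h₁ h₂
  refine hlt.le.trans_eq ?_
  rw [add_add_add_comm, ENNReal.add_halves]

lemma norm_sq_of_mem_stinespringSet {r : HilbertRep.{u, w} A} {φ : CBMaps A H}
    {V : H →L[ℂ] r.K} (hV : V ∈ stinespringSet r φ) :
    ‖V‖ ^ 2 = ‖(φ : A →ₗ[ℂ] (H →L[ℂ] H)) 1‖ := by
  rw [hV 1, map_one, ContinuousLinearMap.one_def, ContinuousLinearMap.id_comp,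
    ContinuousLinearMap.norm_adjoint_comp_self, sq]

/-- Compressions of one operator depend Lipschitz continuously on the compressing operator. -/
lemma norm_compression_sub_le {K : Type*} [NormedAddCommGroup K] [InnerProductSpace ℂ K]
    [CompleteSpace K] (T : K →L[ℂ] K) (V W : H →L[ℂ] K) :
    ‖ContinuousLinearMap.adjoint V ∘L T ∘L V - ContinuousLinearMap.adjoint W ∘L T ∘L W‖ ≤
      ‖T‖ * (‖V‖ + ‖W‖) * ‖V - W‖ := by
  have key : ContinuousLinearMap.adjoint V ∘L T ∘L V - ContinuousLinearMap.adjoint W ∘L T ∘L W =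
      ContinuousLinearMap.adjoint V ∘L T ∘L (V - W) +
        ContinuousLinearMap.adjoint (V - W) ∘L T ∘L W := by
    rw [map_sub]
    ext x
    simp
  have bound : ∀ X Y : H →L[ℂ] K,
      ‖ContinuousLinearMap.adjoint X ∘L T ∘L Y‖ ≤ ‖X‖ * (‖T‖ * ‖Y‖) := fun X Y => by
    refine (ContinuousLinearMap.opNorm_comp_le _ _).trans ?_
    rw [LinearIsometryEquiv.norm_map]
    gcongr
    exact ContinuousLinearMap.opNorm_comp_le _ _
  rw [key]
  refine (norm_add_le _ _).trans ((add_le_add (bound _ _) (bound _ _)).trans_eq ?_)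
  ring

lemma eq_of_eBures_eq_zero {φ ψ : CBMaps A H} (h : eBures φ ψ = 0) : φ = ψ := by
  refine Subtype.ext (LinearMap.ext fun a => ?_)
  set C : ℝ := √‖(φ : A →ₗ[ℂ] (H →L[ℂ] H)) 1‖ + √‖(ψ : A →ₗ[ℂ] (H →L[ℂ] H)) 1‖ with hC
  have hC0 : 0 ≤ C := by positivity
  rw [← sub_eq_zero, ← norm_le_zero_iff]
  refine le_of_forall_pos_le_add fun ε hε => ?_
  have hδ : 0 < ε / (‖a‖ * C + 1) := by positivity
  obtain ⟨r, V, W, hV, hW, hVW⟩ := eBures_lt_iff.1 (h ▸ ENNReal.ofReal_pos.2 hδ)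
  rw [ENNReal.ofReal_lt_ofReal_iff hδ] at hVW
  have hnV : ‖V‖ = √‖(φ : A →ₗ[ℂ] (H →L[ℂ] H)) 1‖ := by
    rw [← norm_sq_of_mem_stinespringSet hV, Real.sqrt_sq (norm_nonneg _)]
  have hnW : ‖W‖ = √‖(ψ : A →ₗ[ℂ] (H →L[ℂ] H)) 1‖ := by
    rw [← norm_sq_of_mem_stinespringSet hW, Real.sqrt_sq (norm_nonneg _)]
  have hπ : ‖r.π a‖ ≤ ‖a‖ := NonUnitalStarAlgHom.norm_apply_le r.π a
  rw [zero_add, hV a, hW a]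
  calc _ ≤ ‖r.π a‖ * (‖V‖ + ‖W‖) * ‖V - W‖ := norm_compression_sub_le _ _ _
    _ ≤ ‖a‖ * C * (ε / (‖a‖ * C + 1)) := by rw [hC, hnV, hnW]; gcongr
    _ = ε / (‖a‖ * C + 1) * (‖a‖ * C) := mul_comm _ _
    _ ≤ ε / (‖a‖ * C + 1) * (‖a‖ * C + 1) := by gcongr; linarith
    _ = ε := by field_simp

lemma bures_self (φ : CPCone A H) : bures φ φ = 0 := by
  rw [bures_eq_toReal, eBures_self, ENNReal.toReal_zero]

lemma bures_comm (φ ψ : CPCone A H) : bures φ ψ = bures ψ φ := by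
  rw [bures_eq_toReal, eBures_comm, bures_eq_toReal]

lemma bures_triangle (φ ψ χ : CPCone A H) : bures φ χ ≤ bures φ ψ + bures ψ χ := by
  rw [bures_eq_toReal, bures_eq_toReal, bures_eq_toReal,
    ← ENNReal.toReal_add (eBures_ne_top _ _) (eBures_ne_top _ _)]
  exact ENNReal.toReal_mono (ENNReal.add_ne_top.2 ⟨eBures_ne_top _ _, eBures_ne_top _ _⟩)
    (eBures_triangle φ ψ χ)

lemma eq_of_bures_eq_zero {φ ψ : CPCone A H} (h : bures φ ψ = 0) : φ = ψ := by
  rw [bures_eq_toReal, ENNReal.toReal_eq_zero_iff] at h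
  exact Subtype.ext (eq_of_eBures_eq_zero (h.resolve_right (eBures_ne_top φ ψ)))

/-- The metric space `(𝒞, β)`. -/
abbrev buresMetricSpace : MetricSpace (CPCone A H) where
  dist := bures
  dist_self := bures_self
  dist_comm := bures_comm
  dist_triangle := bures_triangle
  eq_of_dist_eq_zero := eq_of_bures_eq_zero

end Bures

/-! ### Estimates for completely bounded maps -/

section Wittstock

variable {A : Type u} [CStarAlgebra A]

/-- A rectangular matrix `R × J` over `A`, padded to a square matrix indexed by `R ⊕ J`. -/
def padMatrix {R J : Type*} (a : R → J → A) : CStarMatrix (R ⊕ J) (R ⊕ J) A :=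
  CStarMatrix.ofMatrix (Matrix.fromBlocks 0 (Matrix.of a) 0 0)

lemma star_padMatrix_mul_padMatrix {R J : Type*} [Fintype R] [Fintype J] (a b : R → J → A) :
    star (padMatrix a) * padMatrix b = CStarMatrix.ofMatrix
      (Matrix.fromBlocks 0 0 0 (Matrix.of fun i j => ∑ r, star (a r i) * b r j)) := by
  ext i j
  rw [CStarMatrix.mul_apply, Fintype.sum_sum_type]
  rcases i with i | i <;> rcases j with j | j <;>
    simp [padMatrix, CStarMatrix.star_apply, CStarMatrix.ofMatrix_apply]

variable [PartialOrder A] [StarOrderedRing A]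
variable {H : Type v} [NormedAddCommGroup H] [InnerProductSpace ℂ H]

/-- The scalar quadratic form of an operator matrix is bounded by its norm. -/
lemma CStarMatrix.norm_sum_inner_le [CompleteSpace H] {n : Type*} [Fintype n]
    (M : CStarMatrix n n (H →L[ℂ] H)) (x y : n → H) :
    ‖∑ i, ∑ j, ⟪x i, M i j (y j)⟫_ℂ‖ ≤ ‖M‖ * √(∑ i, ‖x i‖ ^ 2) * √(∑ i, ‖y i‖ ^ 2) := by
  classical
  set z : n → H := fun i => ∑ j, M i j (y j) with hz
  have hz2 : ∑ i, ‖z i‖ ^ 2 ≤ ‖M‖ ^ 2 * ∑ i, ‖y i‖ ^ 2 := by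
    have h0 : star M * M ≤ algebraMap ℝ (CStarMatrix n n (H →L[ℂ] H)) (‖M‖ ^ 2) := by
      have := IsSelfAdjoint.le_algebraMap_norm_self (IsSelfAdjoint.star_mul_self M)
      rwa [CStarRing.norm_star_mul_self, ← sq] at this
    have h1 := CStarMatrix.sum_inner_nonneg (sub_nonneg.2 h0) y
    have h2 : ∀ i j, (algebraMap ℝ (CStarMatrix n n (H →L[ℂ] H)) (‖M‖ ^ 2) - star M * M) i j =
        (if i = j then ((‖M‖ ^ 2 : ℝ) : ℂ) • (1 : H →L[ℂ] H) else 0) -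
          ∑ l, star (M l i) * M l j := by
      intro i j
      rw [CStarMatrix.sub_apply, CStarMatrix.mul_apply, Algebra.algebraMap_eq_smul_one]
      congr 1
      change ((‖M‖ ^ 2 : ℝ) : ℂ) • (1 : CStarMatrix n n (H →L[ℂ] H)) i j = _
      rw [CStarMatrix.one_apply]
      split_ifs <;> simp
    have h3 : ∑ i, ∑ j, ⟪y i, (algebraMap ℝ (CStarMatrix n n (H →L[ℂ] H)) (‖M‖ ^ 2) -
        star M * M) i j (y j)⟫_ℂ = ((‖M‖ ^ 2 * ∑ i, ‖y i‖ ^ 2 - ∑ l, ‖z l‖ ^ 2 : ℝ) : ℂ) := by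
      have h6 : ∀ i j, ⟪y i, (algebraMap ℝ (CStarMatrix n n (H →L[ℂ] H)) (‖M‖ ^ 2) -
          star M * M) i j (y j)⟫_ℂ =
          ⟪y i, (if i = j then ((‖M‖ ^ 2 : ℝ) : ℂ) • (1 : H →L[ℂ] H) else 0) (y j)⟫_ℂ -
            ⟪y i, (∑ l, star (M l i) * M l j) (y j)⟫_ℂ := fun i j => by
        rw [h2, _root_.sub_apply, inner_sub_right]
      rw [Finset.sum_congr rfl fun i _ => Finset.sum_congr rfl fun j _ => h6 i j]
      simp only [Finset.sum_sub_distrib]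
      rw [Complex.ofReal_sub]
      congr 1
      · rw [Finset.mul_sum, Complex.ofReal_sum]
        refine Finset.sum_congr rfl fun i _ => ?_
        rw [Finset.sum_eq_single i (fun j _ hj => by simp [hj.symm]) (by simp), if_pos rfl,
          _root_.smul_apply, one_apply_eq_self, inner_smul_right, inner_self_eq_ofReal_norm_sq,
          ← Complex.ofReal_mul]
      · rw [Complex.ofReal_sum]
        simp only [← inner_self_eq_ofReal_norm_sq, hz, sum_apply, sum_inner, inner_sum,
          mul_apply_eq_comp, ContinuousLinearMap.star_eq_adjoint,
          ContinuousLinearMap.adjoint_inner_right]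
        refine (Finset.sum_congr rfl fun i _ => Finset.sum_comm).trans (Finset.sum_comm.trans ?_)
        exact Finset.sum_congr rfl fun l _ => Finset.sum_comm
    rw [h3, Complex.zero_le_real] at h1
    linarith
  have h4 : ∑ i, ∑ j, ⟪x i, M i j (y j)⟫_ℂ = ∑ i, ⟪x i, z i⟫_ℂ := by simp [hz]
  have h5 : √(∑ i, ‖z i‖ ^ 2) ≤ ‖M‖ * √(∑ i, ‖y i‖ ^ 2) := by
    refine (Real.sqrt_le_sqrt hz2).trans_eq ?_
    rw [Real.sqrt_mul (sq_nonneg _), Real.sqrt_sq (norm_nonneg _)]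
  calc ‖∑ i, ∑ j, ⟪x i, M i j (y j)⟫_ℂ‖ ≤ ∑ i, ‖x i‖ * ‖z i‖ := by
        rw [h4]
        exact (norm_sum_le _ _).trans (Finset.sum_le_sum fun i _ => norm_inner_le_norm _ _)
    _ ≤ √(∑ i, ‖x i‖ ^ 2) * √(∑ i, ‖z i‖ ^ 2) := Real.sum_mul_le_sqrt_mul_sqrt _ _ _
    _ ≤ √(∑ i, ‖x i‖ ^ 2) * (‖M‖ * √(∑ i, ‖y i‖ ^ 2)) := by gcongr
    _ = _ := by ring

lemma bddAbove_cbNorm [CompleteSpace H] (φ : CBMaps A H) :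
    BddAbove {r : ℝ | ∃ (n : ℕ) (M : CStarMatrix (Fin n) (Fin n) A), ‖M‖ ≤ 1 ∧
      r = ‖M.map (φ : A →ₗ[ℂ] (H →L[ℂ] H))‖} := by
  obtain ⟨C, hC⟩ := φ.2
  refine ⟨|C|, ?_⟩
  rintro _ ⟨n, M, hM, rfl⟩
  calc _ ≤ C * ‖M‖ := hC n M
    _ ≤ |C| * 1 := mul_le_mul (le_abs_self C) hM (norm_nonneg _) (abs_nonneg _)
    _ = |C| := mul_one _

lemma CStarMatrix.map_smul_linearMap {B C : Type*} [AddCommGroup B] [Module ℂ B] [AddCommGroup C]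
    [Module ℂ C] {m n : Type*} (φ : B →ₗ[ℂ] C) (c : ℂ) (M : CStarMatrix m n B) :
    (c • M).map φ = c • M.map φ := by
  ext i j
  simp

lemma norm_map_le_cbNorm [CompleteSpace H] (φ : CBMaps A H) {n : ℕ}
    (M : CStarMatrix (Fin n) (Fin n) A) :
    ‖M.map (φ : A →ₗ[ℂ] (H →L[ℂ] H))‖ ≤ cbNorm φ * ‖M‖ := by
  rcases eq_or_ne M 0 with rfl | hM
  · have : (0 : CStarMatrix (Fin n) (Fin n) A).map (φ : A →ₗ[ℂ] (H →L[ℂ] H)) = 0 := by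
      ext i j
      simp
    rw [this]
    simp
  have hM' : 0 < ‖M‖ := norm_pos_iff.2 hM
  have h : ‖(((‖M‖ : ℂ)⁻¹ • M).map (φ : A →ₗ[ℂ] (H →L[ℂ] H)))‖ ≤ cbNorm φ := by
    refine le_csSup (bddAbove_cbNorm φ) ⟨n, _, ?_, rfl⟩
    rw [norm_smul, norm_inv, Complex.norm_real, norm_norm, inv_mul_cancel₀ hM'.ne']
  rw [CStarMatrix.map_smul_linearMap, norm_smul, norm_inv, Complex.norm_real, norm_norm] at h
  rwa [inv_mul_le_iff₀ hM', mul_comm] at h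

lemma cbNorm_nonneg [CompleteSpace H] (φ : CBMaps A H) : 0 ≤ cbNorm φ :=
  Real.sSup_nonneg fun _ ⟨_, _, _, hr⟩ => hr ▸ norm_nonneg _

/-- The bilinear form of the complete contractivity of `φ`, for matrices over any finite type. -/
lemma norm_sum_inner_map_le [CompleteSpace H] {φ : CBMaps A H} (hφ : cbNorm φ ≤ 1) {N : Type*}
    [Fintype N] (M : CStarMatrix N N A) (x y : N → H) :
    ‖∑ i, ∑ j, ⟪x i, (φ : A →ₗ[ℂ] (H →L[ℂ] H)) (M i j) (y j)⟫_ℂ‖ ≤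
      ‖M‖ * √(∑ i, ‖x i‖ ^ 2) * √(∑ i, ‖y i‖ ^ 2) := by
  let e := Fintype.equivFin N
  have h := CStarMatrix.norm_sum_inner_le
    ((CStarMatrix.reindexₐ ℂ A e M).map (φ : A →ₗ[ℂ] (H →L[ℂ] H))) (x ∘ e.symm) (y ∘ e.symm)
  have h1 : ∀ F : N → ℝ, ∑ i, F (e.symm i) = ∑ i, F i := fun F => e.symm.sum_comp F
  have h2 : ∀ F : N → ℂ, ∑ i, F (e.symm i) = ∑ i, F i := fun F => e.symm.sum_comp F
  simp only [CStarMatrix.map_apply, CStarMatrix.reindexₐ_apply, Function.comp_apply] at h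
  rw [h1 fun i => ‖x i‖ ^ 2, h1 fun i => ‖y i‖ ^ 2] at h
  rw [← h2]
  simp_rw [← h2 fun j => ⟪x _, (φ : A →ₗ[ℂ] (H →L[ℂ] H)) (M _ j) (y j)⟫_ℂ]
  refine h.trans ?_
  have h3 : ‖(CStarMatrix.reindexₐ ℂ A e M).map (φ : A →ₗ[ℂ] (H →L[ℂ] H))‖ ≤ ‖M‖ := by
    refine (norm_map_le_cbNorm φ _).trans ?_
    have : ‖CStarMatrix.reindexₐ ℂ A e M‖ = ‖M‖ := StarAlgEquiv.norm_map _ _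
    rw [this]
    exact mul_le_of_le_one_left (norm_nonneg _) hφ
  gcongr

/-- A column matrix `u` with `u* u = 1 - Y* Y`, where `Y` is a scalar matrix, is a contraction. -/
lemma norm_padMatrix_le {R J : Type*} [Fintype R] [Fintype J] [DecidableEq J] (u : R → J → A)
    (Y : Matrix J J ℂ)
    (h : ∀ i j, ∑ r, star (u r i) * u r j = (1 - Y.conjTranspose * Y) i j • (1 : A)) :
    ‖padMatrix u‖ ≤ 1 := by
  classical
  let Z : CStarMatrix (R ⊕ J) (R ⊕ J) A :=
    CStarMatrix.ofMatrix (Matrix.fromBlocks 1 0 0 (Y.map fun c => c • (1 : A)))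
  have hZ : 1 - star (padMatrix u) * padMatrix u = star Z * Z := by
    ext i j
    rw [CStarMatrix.sub_apply, star_padMatrix_mul_padMatrix, CStarMatrix.mul_apply,
      Fintype.sum_sum_type, CStarMatrix.one_apply]
    rcases i with i | i <;> rcases j with j | j
    · by_cases hij : i = j <;>
        simp [Z, CStarMatrix.star_apply, CStarMatrix.ofMatrix_apply, Matrix.one_apply, hij, Ne.symm]
    · simp [Z, CStarMatrix.star_apply, CStarMatrix.ofMatrix_apply]
    · simp [Z, CStarMatrix.star_apply, CStarMatrix.ofMatrix_apply]
    · simp [Z, CStarMatrix.star_apply, CStarMatrix.ofMatrix_apply, h, Matrix.one_apply, sub_smul,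
        Matrix.mul_apply, Finset.sum_smul, smul_smul]
      exact Finset.sum_congr rfl fun _ _ => by rw [mul_comm]
  have h1 : star (padMatrix u) * padMatrix u ≤ 1 := by
    rw [← sub_nonneg, hZ]
    exact star_mul_self_nonneg Z
  have h2 := (CStarAlgebra.norm_le_one_iff_of_nonneg _ (star_mul_self_nonneg (padMatrix u))).2 h1
  rw [CStarRing.norm_star_mul_self] at h2
  nlinarith [norm_nonneg (padMatrix u)]

/-- Complete contractivity in the form used for dilation: if `u` and `v` are contractive matrices
over `A`, then `φ` applied entrywise to `u* v` gives a contractive form. -/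
lemma norm_sum_inner_map_star_mul_le [CompleteSpace H] {φ : CBMaps A H} (hφ : cbNorm φ ≤ 1)
    {R J : Type*} [Fintype R] [Fintype J] {u v : R → J → A} (hu : ‖padMatrix u‖ ≤ 1)
    (hv : ‖padMatrix v‖ ≤ 1) (x y : J → H) :
    ‖∑ i, ∑ j, ⟪x i, (φ : A →ₗ[ℂ] (H →L[ℂ] H)) (∑ r, star (u r i) * v r j) (y j)⟫_ℂ‖ ≤
      √(∑ i, ‖x i‖ ^ 2) * √(∑ i, ‖y i‖ ^ 2) := by
  have h := norm_sum_inner_map_le hφ (star (padMatrix u) * padMatrix v)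
    (Sum.elim (0 : R → H) x) (Sum.elim (0 : R → H) y)
  rw [star_padMatrix_mul_padMatrix] at h
  simp only [Fintype.sum_sum_type, CStarMatrix.ofMatrix_apply, Matrix.fromBlocks_apply₂₂,
    Sum.elim_inl, Sum.elim_inr, Pi.zero_apply, inner_zero_left, map_zero, inner_zero_right,
    Finset.sum_const_zero, zero_add, norm_zero, ne_eq, OfNat.ofNat_ne_zero, not_false_eq_true,
    zero_pow, Matrix.of_apply] at h
  refine h.trans ?_
  rw [mul_assoc, ← star_padMatrix_mul_padMatrix]
  refine mul_le_of_le_one_left (by positivity) ((norm_mul_le _ _).trans ?_)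
  rw [norm_star]
  exact mul_le_one₀ hu (norm_nonneg _) hv

lemma nonneg_of_smul_one_nonneg [Nontrivial A] {c : ℂ} (h : 0 ≤ c • (1 : A)) : 0 ≤ c := by
  have h1 : (starRingEnd ℂ c) • (1 : A) = c • 1 := by
    have := (IsSelfAdjoint.of_nonneg h).star_eq
    simpa using this
  have h2 : starRingEnd ℂ c = c := smul_left_injective ℂ (one_ne_zero (α := A)) h1
  obtain ⟨r, rfl⟩ := Complex.conj_eq_iff_real.1 h2
  rw [Complex.zero_le_real]
  by_contra! hr
  have h3 : 0 ≤ ((-r : ℝ) : ℂ) • (1 : A) := by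
    have : ((-r : ℝ) : ℂ) • (1 : A) =
        star (((√(-r) : ℝ) : ℂ) • (1 : A)) * ((√(-r) : ℝ) : ℂ) • 1 := by
      rw [star_smul, star_one, smul_mul_smul_comm, one_mul, Complex.star_def, Complex.conj_ofReal,
        ← Complex.ofReal_mul, Real.mul_self_sqrt (by linarith)]
    rw [this]
    exact star_mul_self_nonneg _
  have h4 : ((r : ℝ) : ℂ) • (1 : A) = 0 := by
    refine le_antisymm ?_ h
    rw [Complex.ofReal_neg, neg_smul] at h3
    exact neg_nonneg.1 h3
  rw [smul_eq_zero] at h4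
  rcases h4 with h4 | h4
  · exact hr.ne (by exact_mod_cast h4)
  · exact one_ne_zero h4

/-- A scalar matrix that becomes a Gram matrix over `A` is positive semidefinite. -/
lemma posSemidef_of_sum_star_mul [Nontrivial A] {R J : Type*} [Fintype R] [Fintype J]
    {a : R → J → A} {c : Matrix J J ℂ}
    (hc : ∀ i j, ∑ r, star (a r i) * a r j = c i j • (1 : A)) : c.PosSemidef := by
  refine Matrix.PosSemidef.of_dotProduct_mulVec_nonneg ?_ fun x => ?_
  · ext i j
    refine smul_left_injective ℂ (one_ne_zero (α := A)) ?_
    change star (c j i) • (1 : A) = c i j • (1 : A)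
    rw [← hc, ← star_one A, ← star_smul, ← hc, star_sum]
    simp
  · refine nonneg_of_smul_one_nonneg (A := A) ?_
    have : (star x ⬝ᵥ c.mulVec x) • (1 : A) =
        ∑ r, star (∑ i, x i • a r i) * ∑ i, x i • a r i := by
      simp only [dotProduct, Matrix.mulVec, Finset.mul_sum, Finset.sum_smul, star_sum,
        Finset.sum_mul, star_smul, smul_mul_smul_comm]
      rw [Finset.sum_comm]
      refine (Finset.sum_congr rfl fun j _ => Finset.sum_congr rfl fun i _ => ?_).trans
        (Finset.sum_congr rfl fun j _ => Finset.sum_comm) |>.trans Finset.sum_comm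
      rw [← Finset.smul_sum, hc, smul_smul]
      simp
      ring_nf
    rw [this]
    exact Finset.sum_nonneg fun r _ => star_mul_self_nonneg _

open scoped MatrixOrder in
/-- Positive semidefinite `c` can be perturbed to `B* B` with `B` invertible. -/
lemma exists_isUnit_conjTranspose_mul_self {J : Type*} [Fintype J] [DecidableEq J]
    {c : Matrix J J ℂ} (hc : c.PosSemidef) {ε : ℝ} (hε : 0 < ε) :
    ∃ B : Matrix J J ℂ, IsUnit B ∧ B.conjTranspose * B = c + (ε : ℂ) • 1 := by
  have h1 : (c + (ε : ℂ) • (1 : Matrix J J ℂ)).PosDef := by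
    exact Matrix.PosDef.posSemidef_add hc (Matrix.PosDef.one.smul (Complex.zero_lt_real.2 hε))
  obtain ⟨B, hB⟩ := CStarAlgebra.nonneg_iff_eq_star_mul_self.1 h1.posSemidef.nonneg
  refine ⟨B, ?_, hB.symm⟩
  have h2 := h1.isUnit
  rw [hB] at h2
  exact isUnit_of_mul_isUnit_right h2

end Wittstock

/-! ### The basic inequality behind the dilation theorem -/

section Gram

variable {A : Type u} [CStarAlgebra A]

lemma sum_star_sum_smul_mul {R J : Type*} [Fintype R] [Fintype J] (u v : R → J → A) (f g : J → ℂ) :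
    ∑ r, star (∑ p, f p • u r p) * ∑ q, g q • v r q =
      ∑ p, ∑ q, (starRingEnd ℂ (f p) * g q) • ∑ r, star (u r p) * v r q := by
  have h1 : ∀ r, star (∑ p, f p • u r p) * ∑ q, g q • v r q =
      ∑ p, ∑ q, (starRingEnd ℂ (f p) * g q) • (star (u r p) * v r q) := fun r => by
    rw [star_sum, Finset.sum_mul_sum]
    simp [smul_smul, mul_comm]
  simp only [h1]
  rw [Finset.sum_comm]
  refine Finset.sum_congr rfl fun p _ => ?_
  rw [Finset.sum_comm]
  exact Finset.sum_congr rfl fun q _ => Finset.smul_sum.symm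

variable [PartialOrder A] [StarOrderedRing A]
variable {H : Type v} [NormedAddCommGroup H] [InnerProductSpace ℂ H]

/-- Approximate polar decomposition: a matrix over `A` with scalar Gram matrix `c` is `u B` with `u`
a contraction and `B` a scalar matrix with `B* B = c + ε`. -/
lemma exists_contraction_mul [Nontrivial A] {R J : Type*} [Fintype R] [Fintype J] [DecidableEq J]
    {a : R → J → A} {c : Matrix J J ℂ} (hc : ∀ i j, ∑ r, star (a r i) * a r j = c i j • (1 : A))
    {ε : ℝ} (hε : 0 < ε) :
    ∃ (u : R → J → A) (B : Matrix J J ℂ), ‖padMatrix u‖ ≤ 1 ∧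
      B.conjTranspose * B = c + (ε : ℂ) • 1 ∧ ∀ r i, a r i = ∑ p, B p i • u r p := by
  obtain ⟨B, hB, hBc⟩ := exists_isUnit_conjTranspose_mul_self (posSemidef_of_sum_star_mul hc) hε
  obtain ⟨C, hBC, hCB⟩ := isUnit_iff_exists.1 hB
  refine ⟨fun r p => ∑ i, C i p • a r i, B, ?_, hBc, fun r i => ?_⟩
  · refine norm_padMatrix_le _ (((√ε : ℝ) : ℂ) • C) fun p q => ?_
    have h1 : (1 : Matrix J J ℂ) - (((√ε : ℝ) : ℂ) • C).conjTranspose * (((√ε : ℝ) : ℂ) • C) =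
        C.conjTranspose * c * C := by
      have h2 : C.conjTranspose * (B.conjTranspose * B) * C = 1 := by
        rw [← mul_assoc, ← Matrix.conjTranspose_mul, hBC, Matrix.conjTranspose_one, one_mul, hBC]
      rw [hBc, mul_add, add_mul] at h2
      rw [sub_eq_iff_eq_add, ← h2]
      congr 1
      simp only [Matrix.conjTranspose_smul, Complex.star_def, Complex.conj_ofReal,
        Matrix.smul_mul, Matrix.mul_smul, smul_smul, mul_one]
      rw [← Complex.ofReal_mul, Real.mul_self_sqrt hε.le]
    rw [h1, sum_star_sum_smul_mul a a (C · p) (C · q), Matrix.mul_apply, Finset.sum_smul]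
    rw [Finset.sum_comm]
    refine Finset.sum_congr rfl fun j _ => ?_
    rw [Matrix.mul_apply, Finset.sum_mul, Finset.sum_smul]
    refine Finset.sum_congr rfl fun i _ => ?_
    rw [hc, smul_smul, Matrix.conjTranspose_apply]
    congr 1
    change starRingEnd ℂ (C i p) * C j q * c i j = starRingEnd ℂ (C i p) * c i j * C j q
    ring
  · simp only [Finset.smul_sum, smul_smul]
    rw [Finset.sum_comm]
    simp only [← Finset.sum_smul]
    have h3 : ∀ l, ∑ p, B p i * C l p = (C * B) l i := fun l => by
      rw [Matrix.mul_apply]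
      exact Finset.sum_congr rfl fun p _ => mul_comm _ _
    simp [h3, hCB, Matrix.one_apply]

/-- If `a* a = c` and `b* b = d` are scalar matrices, then
`2 |∑ ⟨e_i, φ((a* b)_ij) e_j⟩| ≤ tr c + tr d` for every complete contraction `φ`. This is the
positivity of the values prescribed for the dilation kernel of `φ`. -/
lemma re_sum_inner_map_nonneg [CompleteSpace H] [Nontrivial A] {φ : CBMaps A H}
    (hφ : cbNorm φ ≤ 1) {R J : Type*} [Fintype R] [Fintype J] {a b : R → J → A}
    {c d : Matrix J J ℂ} (hc : ∀ i j, ∑ r, star (a r i) * a r j = c i j • (1 : A))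
    (hd : ∀ i j, ∑ r, star (b r i) * b r j = d i j • (1 : A)) {e : J → H} (he : Orthonormal ℂ e) :
    0 ≤ c.trace.re + d.trace.re +
      2 * (∑ i, ∑ j, ⟪e i, (φ : A →ₗ[ℂ] (H →L[ℂ] H)) (∑ r, star (a r i) * b r j) (e j)⟫_ℂ).re := by
  classical
  -- `2 |⟨x, φ(m) y⟩| ≤ ‖x‖² + ‖y‖²` for the perturbed factorizations, followed by `ε → 0`.
  refine le_of_forall_pos_le_add fun δ hδ => ?_
  set n : ℝ := (Fintype.card J : ℝ) with hn
  have hn0 : 0 ≤ n := Nat.cast_nonneg _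
  set ε : ℝ := δ / (2 * n + 1) with hεdef
  have hε : 0 < ε := by positivity
  obtain ⟨u, B, hu, hB, ha⟩ := exists_contraction_mul hc hε
  obtain ⟨v, D, hv, hD, hb⟩ := exists_contraction_mul hd hε
  have hnorm : ∀ (B c : Matrix J J ℂ), B.conjTranspose * B = c + (ε : ℂ) • 1 →
      ∑ p, ‖∑ i, B p i • e i‖ ^ 2 = c.trace.re + ε * n := by
    intro B c hB
    have h1 : ∀ p, ‖∑ i, B p i • e i‖ ^ 2 = (∑ i, starRingEnd ℂ (B p i) * B p i).re := fun p => by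
      have h := he.inner_sum (B p) (B p) Finset.univ
      rw [inner_self_eq_ofReal_norm_sq] at h
      rw [← h, Complex.ofReal_re]
    simp only [h1]
    rw [← Complex.re_sum, Finset.sum_comm]
    have h2 : ∀ i, ∑ p, starRingEnd ℂ (B p i) * B p i = (c + (ε : ℂ) • 1) i i := fun i => by
      rw [← hB, Matrix.mul_apply]
      rfl
    simp only [h2]
    simp [Matrix.trace, Finset.sum_add_distrib, hn, mul_comm]
  have key : ∑ i, ∑ j, ⟪e i, (φ : A →ₗ[ℂ] (H →L[ℂ] H)) (∑ r, star (a r i) * b r j) (e j)⟫_ℂ =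
      ∑ p, ∑ q, ⟪∑ i, B p i • e i, (φ : A →ₗ[ℂ] (H →L[ℂ] H)) (∑ r, star (u r p) * v r q)
        (∑ j, D q j • e j)⟫_ℂ := by
    have h1 : ∀ i j, ∑ r, star (a r i) * b r j =
        ∑ p, ∑ q, (starRingEnd ℂ (B p i) * D q j) • ∑ r, star (u r p) * v r q := fun i j => by
      simp only [ha, hb]
      exact sum_star_sum_smul_mul u v (B · i) (D · j)
    have h2 : ∀ i j, ⟪e i, (φ : A →ₗ[ℂ] (H →L[ℂ] H)) (∑ r, star (a r i) * b r j) (e j)⟫_ℂ =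
        ∑ p, ∑ q, starRingEnd ℂ (B p i) * D q j *
          ⟪e i, (φ : A →ₗ[ℂ] (H →L[ℂ] H)) (∑ r, star (u r p) * v r q) (e j)⟫_ℂ := fun i j => by
      rw [h1]
      simp only [map_sum, map_smul, sum_apply, smul_apply, inner_sum, inner_smul_right]
    have h3 : ∀ p q, ⟪∑ i, B p i • e i, (φ : A →ₗ[ℂ] (H →L[ℂ] H)) (∑ r, star (u r p) * v r q)
        (∑ j, D q j • e j)⟫_ℂ = ∑ i, ∑ j, starRingEnd ℂ (B p i) * D q j *
          ⟪e i, (φ : A →ₗ[ℂ] (H →L[ℂ] H)) (∑ r, star (u r p) * v r q) (e j)⟫_ℂ := fun p q => by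
      rw [sum_inner]
      refine Finset.sum_congr rfl fun i _ => ?_
      rw [map_sum, inner_sum]
      refine Finset.sum_congr rfl fun j _ => ?_
      rw [map_smul, inner_smul_left, inner_smul_right, mul_assoc]
    simp only [h2, h3]
    simp only [← Finset.sum_product' Finset.univ Finset.univ]
    exact Finset.sum_comm
  have hmain := norm_sum_inner_map_star_mul_le hφ hu hv (fun p => ∑ i, B p i • e i)
    (fun q => ∑ j, D q j • e j)
  rw [← key] at hmain
  set z := ∑ i, ∑ j, ⟪e i, (φ : A →ₗ[ℂ] (H →L[ℂ] H)) (∑ r, star (a r i) * b r j) (e j)⟫_ℂ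
  have h4 : -‖z‖ ≤ z.re := (abs_le.1 (Complex.abs_re_le_norm z)).1
  rw [hnorm B c hB, hnorm D d hD] at hmain
  have hB0 : 0 ≤ c.trace.re + ε * n := hnorm B c hB ▸ Finset.sum_nonneg fun _ _ => sq_nonneg _
  have hD0 : 0 ≤ d.trace.re + ε * n := hnorm D d hD ▸ Finset.sum_nonneg fun _ _ => sq_nonneg _
  have h5 := sq_nonneg (√(c.trace.re + ε * n) - √(d.trace.re + ε * n))
  have h6 := Real.sq_sqrt hB0
  have h7 := Real.sq_sqrt hD0
  have h8 : 2 * (ε * n) ≤ δ := by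
    have : ε * (2 * n + 1) = δ := div_mul_cancel₀ _ (by positivity)
    linarith
  nlinarith

end Gram

/-! ### Extension of partially prescribed kernels -/

section Extension

variable {A : Type u} [CStarAlgebra A] {X : Type v}

/-- The cone of those finitely supported matrices `m : X × X → A` for which `m + m*` is a finite sum
of matrices `(x(p)* x(q))`. Skew-hermitian matrices lie in the cone, so a real functional that is
nonnegative on it vanishes on them. -/
def kernelCone (A : Type u) [CStarAlgebra A] (X : Type v) : PointedCone ℝ ((X × X) →₀ A) where
  carrier := {m | ∃ (ι : Type) (_ : Fintype ι) (x : ι → X →₀ A),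
    ∀ p q, m (p, q) + star (m (q, p)) = ∑ r, star (x r p) * x r q}
  add_mem' := by
    rintro m m' ⟨ι, _, x, hx⟩ ⟨ι', _, x', hx'⟩
    refine ⟨ι ⊕ ι', inferInstance, Sum.elim x x', fun p q => ?_⟩
    rw [Fintype.sum_sum_type]
    simp only [Sum.elim_inl, Sum.elim_inr, ← hx, ← hx', Finsupp.add_apply, star_add]
    abel
  zero_mem' := ⟨Empty, inferInstance, Empty.elim, by simp⟩
  smul_mem' := by
    rintro c m ⟨ι, _, x, hx⟩
    refine ⟨ι, inferInstance, fun r => ((√(c : ℝ) : ℝ) : ℂ) • x r, fun p q => ?_⟩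
    have h : ∀ r, star ((((√(c : ℝ) : ℝ) : ℂ) • x r) p) * (((√(c : ℝ) : ℝ) : ℂ) • x r) q =
        ((c : ℝ) : ℂ) • (star (x r p) * x r q) := fun r => by
      rw [Finsupp.smul_apply, Finsupp.smul_apply, star_smul, smul_mul_smul_comm, Complex.star_def,
        Complex.conj_ofReal, ← Complex.ofReal_mul, Real.mul_self_sqrt c.2]
    simp only [h, ← Finset.smul_sum, ← hx, smul_add]
    have h2 : ∀ z, (c • m) z = ((c : ℝ) : ℂ) • m z := fun z => rfl
    rw [h2, h2, star_smul, Complex.star_def, Complex.conj_ofReal]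

/-- The finitely supported matrix `(c f(p)* f(q))`. -/
def gramMatrix (f : X →₀ A) (c : ℂ) : (X × X) →₀ A :=
  Finsupp.onFinset (f.support ×ˢ f.support) (fun z => c • (star (f z.1) * f z.2)) (by
    rintro ⟨p, q⟩ h
    rw [Finset.mem_product, Finsupp.mem_support_iff, Finsupp.mem_support_iff]
    refine ⟨fun h0 => h ?_, fun h0 => h ?_⟩ <;> simp_all)

lemma gramMatrix_apply (f : X →₀ A) (c : ℂ) (p q : X) :
    gramMatrix f c (p, q) = c • (star (f p) * f q) := rfl

lemma map_gramMatrix (g : ((X × X) →₀ A) →ₗ[ℝ] ℝ) (f : X →₀ A) (c : ℂ) :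
    g (gramMatrix f c) = ∑ p ∈ f.support, ∑ q ∈ f.support,
      g (Finsupp.single (p, q) (c • (star (f p) * f q))) := by
  conv_lhs => rw [← Finsupp.sum_single (gramMatrix f c)]
  rw [Finsupp.sum_of_support_subset (s := f.support ×ˢ f.support) (gramMatrix f c)
    Finsupp.support_onFinset_subset _ (by simp), map_sum, Finset.sum_product]
  rfl

lemma gramMatrix_one_mem (f : X →₀ A) : gramMatrix f 1 ∈ kernelCone A X := by
  refine ⟨Fin 2, inferInstance, fun _ => f, fun p q => ?_⟩
  simp [gramMatrix_apply, two_mul]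

lemma gramMatrix_mem_of_add_conj (f : X →₀ A) {c : ℂ} (hc : c + starRingEnd ℂ c = 0) :
    gramMatrix f c ∈ kernelCone A X := by
  refine ⟨Empty, inferInstance, Empty.elim, fun p q => ?_⟩
  rw [gramMatrix_apply, gramMatrix_apply, star_smul, star_mul, star_star, ← add_smul]
  simp [hc]

/-- Scalar diagonal matrices dominate: `E_pp + (a at (p, q)) + (a* at (q, p)) + ‖a‖² E_qq` is
positive. -/
lemma exists_diag_add_mem_kernelCone (y : (X × X) →₀ A) : ∃ d : (X × X) →₀ A,
    (∀ p q, ∃ t : ℝ, d (p, q) = (t : ℂ) • (1 : A) ∧ (p ≠ q → t = 0)) ∧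
      d + y ∈ kernelCone A X := by
  classical
  induction y using Finsupp.induction_linear with
  | zero => exact ⟨0, fun p q => ⟨0, by simp⟩, by simp⟩
  | add y y' hy hy' =>
    obtain ⟨d, hd, hdy⟩ := hy
    obtain ⟨d', hd', hdy'⟩ := hy'
    refine ⟨d + d', fun p q => ?_, ?_⟩
    · obtain ⟨t, ht, ht0⟩ := hd p q
      obtain ⟨t', ht', ht0'⟩ := hd' p q
      refine ⟨t + t', by simp [ht, ht', add_smul], fun h => by rw [ht0 h, ht0' h, add_zero]⟩
    · rw [add_add_add_comm]
      exact add_mem hdy hdy'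
  | single z a =>
    obtain ⟨p, q⟩ := z
    obtain ⟨b, hb⟩ := exists_norm_sq_sub_eq_star_mul_self a
    refine ⟨Finsupp.single (p, p) (((1 / 2 : ℝ) : ℂ) • 1) +
      Finsupp.single (q, q) (((‖a‖ ^ 2 / 2 : ℝ) : ℂ) • 1), fun r s => ?_, ?_⟩
    · refine ⟨(if p = r ∧ p = s then 1 / 2 else 0) + (if q = r ∧ q = s then ‖a‖ ^ 2 / 2 else 0),
        ?_, fun hrs => ?_⟩
      · simp only [Finsupp.add_apply, Finsupp.single_apply, Prod.mk.injEq]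
        split_ifs <;> simp [add_smul]
      · rw [if_neg (fun h => hrs (h.1.symm.trans h.2)), if_neg (fun h => hrs (h.1.symm.trans h.2)),
          add_zero]
    · refine ⟨Bool, inferInstance, fun r => bif r then Finsupp.single p 1 + Finsupp.single q a
        else Finsupp.single q b, fun r s => ?_⟩
      have h1 : ((1 / 2 : ℝ) : ℂ) • (1 : A) + ((1 / 2 : ℝ) : ℂ) • (1 : A) = 1 := by
        rw [← add_smul, ← Complex.ofReal_add]
        norm_num
      have h2 : ((‖a‖ ^ 2 / 2 : ℝ) : ℂ) • (1 : A) + ((‖a‖ ^ 2 / 2 : ℝ) : ℂ) • (1 : A) =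
          star a * a + star b * b := by
        rw [← hb, ← add_smul, ← Complex.ofReal_add, add_halves]
        abel
      have h3 : star (((1 / 2 : ℝ) : ℂ) • (1 : A)) = ((1 / 2 : ℝ) : ℂ) • (1 : A) := by
        rw [star_smul, star_one, Complex.star_def, Complex.conj_ofReal]
      have h4 : star (((‖a‖ ^ 2 / 2 : ℝ) : ℂ) • (1 : A)) =
          ((‖a‖ ^ 2 / 2 : ℝ) : ℂ) • (1 : A) := by
        rw [star_smul, star_one, Complex.star_def, Complex.conj_ofReal]
      set α := ((1 / 2 : ℝ) : ℂ) • (1 : A)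
      set β := ((‖a‖ ^ 2 / 2 : ℝ) : ℂ) • (1 : A)
      -- The entries are expressed through the indicators of `p` and `q`.
      let P : X → X → ℂ := fun p t => if p = t then 1 else 0
      have hs1 : ∀ (p t : X) (c : A), Finsupp.single p c t = P p t • c := fun p t c => by
        simp [P, Finsupp.single_apply]
      have hs2 : ∀ (p q r s : X) (c : A),
          Finsupp.single (p, q) c (r, s) = (P p r * P q s) • c := fun p q r s c => by
        by_cases h1 : p = r <;> by_cases h2 : q = s <;> simp [P, h1, h2]
      have hP : ∀ p t, star (P p t) = P p t := fun p t => by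
        by_cases h : p = t <;> simp [P, h]
      simp only [Fintype.sum_bool, cond_true, cond_false, Finsupp.add_apply, hs1, hs2, star_add,
        star_smul, star_mul', hP, star_one, h3, h4, mul_add, add_mul, smul_mul_smul_comm, one_mul,
        mul_one]
      linear_combination (norm := module) (P p r * P p s) • h1 + (P q r * P q s) • h2

/-- M. Riesz extension for kernels: a hermitian kernel that is prescribed on subspaces `D p q`
containing the scalars on the diagonal extends to a positive kernel, provided the prescribed values
are nonnegative on those Gram matrices that lie in the subspaces. -/
lemma exists_isPosKernel_extension (Φ : X → X → A →ₗ[ℝ] ℝ)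
    (hΦ : ∀ p q a, Φ q p (star a) = Φ p q a) (D : X → X → Submodule ℂ A)
    (hD1 : ∀ p, (1 : A) ∈ D p p) (hDstar : ∀ p q, ∀ a ∈ D p q, star a ∈ D q p)
    (hpos : ∀ (ι : Type) [Fintype ι] (x : ι → X →₀ A),
      (∀ p q, ∑ r, star (x r p) * x r q ∈ D p q) → ∀ J : Finset X, (∀ r, (x r).support ⊆ J) →
        0 ≤ ∑ p ∈ J, ∑ q ∈ J, Φ p q (∑ r, star (x r p) * x r q)) :
    ∃ k : X → X → A →ₗ[ℂ] ℂ, IsPosKernel k ∧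
      ∀ p q, ∀ a ∈ D p q, k p q a = (Φ p q a : ℂ) - Complex.I * Φ p q (Complex.I • a) := by
  classical
  let F : ((X × X) →₀ A) →ₗ[ℝ] ℝ := Finsupp.lsum ℝ fun z => Φ z.1 z.2
  have hF : ∀ p q a, F (Finsupp.single (p, q) a) = Φ p q a := fun p q a => by simp [F]
  let dom : Submodule ℝ ((X × X) →₀ A) :=
    { carrier := {m | ∀ p q, m (p, q) ∈ D p q}
      add_mem' := fun h h' p q => add_mem (h p q) (h' p q)
      zero_mem' := fun p q => zero_mem _
      smul_mem' := fun c m h p q => (D p q).smul_mem (c : ℂ) (h p q) }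
  have hnonneg : ∀ m : dom, (m : (X × X) →₀ A) ∈ kernelCone A X → 0 ≤ F.toPMap dom m := by
    rintro ⟨m, hm⟩ hmS
    obtain ⟨ι, _, x, hx⟩ := hmS
    change 0 ≤ F m
    let J : Finset X := m.support.image Prod.fst ∪ m.support.image Prod.snd ∪
      Finset.univ.biUnion fun r => (x r).support
    have hJ : m.support ⊆ J ×ˢ J := fun z hz => by
      simp only [J, Finset.mem_product, Finset.mem_union, Finset.mem_image]
      exact ⟨.inl (.inl ⟨z, hz, rfl⟩), .inl (.inr ⟨z, hz, rfl⟩)⟩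
    have hFm : F m = ∑ p ∈ J, ∑ q ∈ J, Φ p q (m (p, q)) := by
      have : F m = m.sum fun z a => Φ z.1 z.2 a := rfl
      rw [this, Finsupp.sum_of_support_subset _ hJ _ (by simp), Finset.sum_product]
    have h2 : F m + F m = ∑ p ∈ J, ∑ q ∈ J, Φ p q (∑ r, star (x r p) * x r q) := by
      nth_rewrite 2 [hFm]
      rw [Finset.sum_comm, hFm, ← Finset.sum_add_distrib]
      refine Finset.sum_congr rfl fun p _ => ?_
      rw [← Finset.sum_add_distrib]
      refine Finset.sum_congr rfl fun q _ => ?_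
      rw [← hx, map_add, ← hΦ q p]
    have h3 := hpos ι x (fun p q => hx p q ▸ add_mem (hm p q) (hDstar q p _ (hm q p))) J
      fun r => (Finset.subset_biUnion_of_mem (fun r => (x r).support) (Finset.mem_univ r)).trans
        Finset.subset_union_right
    linarith
  have hdense : ∀ y, ∃ m : dom, (m : (X × X) →₀ A) + y ∈ kernelCone A X := by
    intro y
    obtain ⟨d, hd, hdy⟩ := exists_diag_add_mem_kernelCone y
    refine ⟨⟨d, fun p q => ?_⟩, hdy⟩
    obtain ⟨t, ht, ht0⟩ := hd p q
    rw [ht]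
    by_cases hpq : p = q
    · exact hpq ▸ (D p p).smul_mem _ (hD1 p)
    · rw [ht0 hpq]
      simp
  obtain ⟨g, hg, hgpos⟩ := riesz_extension (kernelCone A X) (F.toPMap dom) hnonneg hdense
  have hg' : ∀ p q, ∀ a ∈ D p q, g (Finsupp.single (p, q) a) = Φ p q a := fun p q a ha => by
    rw [← hF]
    refine hg ⟨Finsupp.single (p, q) a, fun p' q' => ?_⟩
    rw [Finsupp.single_apply]
    split_ifs with h
    · simp only [Prod.mk.injEq] at h
      obtain ⟨rfl, rfl⟩ := h
      exact ha
    · exact zero_mem _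
  have hk : ∀ p q a, Module.Dual.extendRCLike (𝕜 := ℂ) (g ∘ₗ Finsupp.lsingle (p, q)) a =
      (g (Finsupp.single (p, q) a) : ℂ) - Complex.I * g (Finsupp.single (p, q) (Complex.I • a)) :=
    fun p q a => Module.Dual.extendRCLike_apply _ _
  refine ⟨fun p q => Module.Dual.extendRCLike (𝕜 := ℂ) (g ∘ₗ Finsupp.lsingle (p, q)),
    fun f => ?_, fun p q a ha => ?_⟩
  · have hI : g (gramMatrix f Complex.I) = 0 := by
      refine le_antisymm ?_ (hgpos _ (gramMatrix_mem_of_add_conj f (by simp)))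
      have h1 : gramMatrix f (-Complex.I) = -gramMatrix f Complex.I := by
        ext ⟨p, q⟩
        rw [Finsupp.neg_apply, gramMatrix_apply, gramMatrix_apply, neg_smul]
      have h2 := hgpos _ (gramMatrix_mem_of_add_conj f (c := -Complex.I) (by simp))
      rw [h1, map_neg] at h2
      linarith
    have h3 : kernelForm (fun p q => Module.Dual.extendRCLike (𝕜 := ℂ)
        (g ∘ₗ Finsupp.lsingle (p, q))) f f = (g (gramMatrix f 1) : ℂ) -
          Complex.I * g (gramMatrix f Complex.I) := by
      rw [map_gramMatrix, map_gramMatrix, kernelForm, Finsupp.sum]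
      simp only [Finsupp.sum, hk, Finset.sum_sub_distrib, Complex.ofReal_sum, Finset.mul_sum,
        one_smul]
    rw [h3, hI]
    simpa using hgpos _ (gramMatrix_one_mem f)
  · rw [hk, hg' p q a ha, hg' p q _ ((D p q).smul_mem _ ha)]

end Extension

/-! ### The dilation kernel of a complete contraction -/

section Dilation

variable {A : Type u} [CStarAlgebra A]

/-- A real functional that is invariant under the involution and is `Re` on the scalars. -/
lemma exists_real_functional [Nontrivial A] : ∃ t : A →ₗ[ℝ] ℝ,
    (∀ a, t (star a) = t a) ∧ ∀ c : ℂ, t (c • (1 : A)) = c.re := by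
  obtain ⟨s, hs⟩ := SeparatingDual.exists_eq_one (R := ℂ) (one_ne_zero (α := A))
  refine ⟨{ toFun a := ((s a).re + (s (star a)).re) / 2
            map_add' a b := ?_
            map_smul' r a := ?_ }, fun a => ?_, fun c => ?_⟩
  · simp only [map_add, star_add, Complex.add_re]
    ring
  · have h : ∀ a : A, s (r • a) = (r : ℂ) * s a := fun a => by
      rw [← Complex.coe_smul r a, map_smul, smul_eq_mul]
    simp only [h, star_smul, star_trivial, Complex.re_ofReal_mul, RingHom.id_apply, smul_eq_mul]
    ring
  · change ((s (star a)).re + (s (star (star a))).re) / 2 = ((s a).re + (s (star a)).re) / 2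
    rw [star_star, add_comm]
  · change ((s (c • 1)).re + (s (star (c • 1))).re) / 2 = c.re
    simp [hs]

variable {H : Type v} [NormedAddCommGroup H] [InnerProductSpace ℂ H] {I : Type w}

open Classical in
/-- The prescribed real parts of the dilation kernel of `φ`: the normalized functional `t` on the
diagonal, and matrix coefficients of `φ` off the diagonal blocks. -/
def cbPrescription (φ : A →ₗ[ℂ] (H →L[ℂ] H)) (e : I → H) (t : A →ₗ[ℝ] ℝ) :
    I ⊕ I → I ⊕ I → A →ₗ[ℝ] ℝ
  | .inl i, .inl j => if i = j then t else 0
  | .inr i, .inr j => if i = j then t else 0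
  | .inl i, .inr j => Complex.reLm ∘ₗ (mapKernel φ (e i) (e j)).restrictScalars ℝ
  | .inr j, .inl i => Complex.reLm ∘ₗ (mapKernel φ (e i) (e j)).restrictScalars ℝ ∘ₗ
      (starL' ℝ : A ≃L[ℝ] A).toLinearEquiv.toLinearMap

/-- The subspaces on which the dilation kernel is prescribed: the scalars in the diagonal blocks,
everything in the off-diagonal blocks. -/
def cbDomain (A : Type u) [CStarAlgebra A] (I : Type w) : I ⊕ I → I ⊕ I → Submodule ℂ A
  | .inl _, .inl _ => ℂ ∙ 1
  | .inr _, .inr _ => ℂ ∙ 1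
  | _, _ => ⊤

variable [CompleteSpace H] [PartialOrder A] [StarOrderedRing A]

/-- Every complete contraction is the off-diagonal block of a positive kernel with normalized
diagonal. A representation generated by this kernel is a dilation of `φ` by two isometries. -/
lemma exists_cbKernel [Nontrivial A] {φ : CBMaps A H} (hφ : cbNorm φ ≤ 1) {e : I → H}
    (he : Orthonormal ℂ e) [DecidableEq I] : ∃ k : I ⊕ I → I ⊕ I → A →ₗ[ℂ] ℂ, IsPosKernel k ∧
      (∀ i j, k (.inl i) (.inl j) 1 = if i = j then 1 else 0) ∧
      (∀ i j, k (.inr i) (.inr j) 1 = if i = j then 1 else 0) ∧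
      ∀ i j a, k (.inl i) (.inr j) a = ⟪e i, (φ : A →ₗ[ℂ] (H →L[ℂ] H)) a (e j)⟫_ℂ := by
  obtain ⟨t, ht, ht1⟩ := exists_real_functional (A := A)
  have herm : ∀ p q a, cbPrescription φ.1 e t q p (star a) = cbPrescription φ.1 e t p q a := by
    rintro (i | i) (j | j) a
    · by_cases hij : i = j
      · simp [cbPrescription, hij, ht]
      · simp [cbPrescription, hij, Ne.symm hij]
    · simp [cbPrescription]
    · simp [cbPrescription]
    · by_cases hij : i = j
      · simp [cbPrescription, hij, ht]
      · simp [cbPrescription, hij, Ne.symm hij]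
  have hone : ∀ p, (1 : A) ∈ cbDomain A I p p := by
    rintro (i | i) <;> exact Submodule.mem_span_singleton_self (1 : A)
  have hstar : ∀ p q, ∀ a ∈ cbDomain A I p q, star a ∈ cbDomain A I q p := by
    have h : ∀ a ∈ (ℂ ∙ (1 : A)), star a ∈ (ℂ ∙ (1 : A)) := fun a ha => by
      obtain ⟨c, rfl⟩ := Submodule.mem_span_singleton.1 ha
      rw [star_smul, star_one]
      exact Submodule.smul_mem _ _ (Submodule.mem_span_singleton_self _)
    rintro (i | i) (j | j) a ha
    · exact h a ha
    · trivial
    · trivial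
    · exact h a ha
  have hpos : ∀ (ι : Type) [Fintype ι] (x : ι → (I ⊕ I) →₀ A),
      (∀ p q, ∑ r, star (x r p) * x r q ∈ cbDomain A I p q) →
      ∀ J : Finset (I ⊕ I), (∀ r, (x r).support ⊆ J) →
        0 ≤ ∑ p ∈ J, ∑ q ∈ J, cbPrescription φ.1 e t p q (∑ r, star (x r p) * x r q) := by
    intro ι _ x hx J hJ
    let L : Finset I := J.image (Sum.elim id id)
    have hJL : J ⊆ L.disjSum L := fun p hp => by
      rcases p with i | i
      · exact Finset.inl_mem_disjSum.2 (Finset.mem_image.2 ⟨_, hp, rfl⟩)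
      · exact Finset.inr_mem_disjSum.2 (Finset.mem_image.2 ⟨_, hp, rfl⟩)
    have h0 : ∀ p, p ∉ J → ∀ r, x r p = 0 := fun p hp r =>
      Finsupp.notMem_support_iff.1 fun h => hp (hJ r h)
    set Φ := cbPrescription φ.1 e t with hΦ
    have hext : ∑ p ∈ J, ∑ q ∈ J, Φ p q (∑ r, star (x r p) * x r q) =
        ∑ p ∈ L.disjSum L, ∑ q ∈ L.disjSum L, Φ p q (∑ r, star (x r p) * x r q) := by
      rw [← Finset.sum_subset hJL fun p _ hp => Finset.sum_eq_zero fun q _ => by simp [h0 p hp]]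
      refine Finset.sum_congr rfl fun p _ => ?_
      exact Finset.sum_subset hJL fun q _ hq => by simp [h0 q hq]
    choose c hc using fun i j : L => Submodule.mem_span_singleton.1 (hx (.inl i) (.inl j))
    choose d hd using fun i j : L => Submodule.mem_span_singleton.1 (hx (.inr i) (.inr j))
    have hmain := re_sum_inner_map_nonneg hφ (a := fun r (i : L) => x r (.inl i))
      (b := fun r (i : L) => x r (.inr i)) (c := Matrix.of c) (d := Matrix.of d)
      (fun i j => (hc i j).symm) (fun i j => (hd i j).symm) (e := fun i : L => e i)
      (he.comp _ Subtype.val_injective)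
    have hll : ∀ i j : L, Φ (.inl i) (.inl j) (∑ r, star (x r (.inl i)) * x r (.inl j)) =
        if i = j then (c i j).re else 0 := fun i j => by
      rw [← hc]
      by_cases hij : i = j <;> simp [hΦ, cbPrescription, hij, ht1]
    have hrr : ∀ i j : L, Φ (.inr i) (.inr j) (∑ r, star (x r (.inr i)) * x r (.inr j)) =
        if i = j then (d i j).re else 0 := fun i j => by
      rw [← hd]
      by_cases hij : i = j <;> simp [hΦ, cbPrescription, hij, ht1]
    have hlr : ∀ i j : L, Φ (.inl i) (.inr j) (∑ r, star (x r (.inl i)) * x r (.inr j)) =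
        (⟪e i, φ.1 (∑ r, star (x r (.inl i)) * x r (.inr j)) (e j)⟫_ℂ).re := fun i j => rfl
    have hrl : ∀ i j : L, Φ (.inr j) (.inl i) (∑ r, star (x r (.inr j)) * x r (.inl i)) =
        (⟪e i, φ.1 (∑ r, star (x r (.inl i)) * x r (.inr j)) (e j)⟫_ℂ).re := fun i j => by
      have : star (∑ r, star (x r (.inr j)) * x r (.inl (i : I))) =
          ∑ r, star (x r (.inl (i : I))) * x r (.inr (j : I)) := by simp
      rw [← this]
      rfl
    rw [hext]
    simp only [Finset.sum_disjSum, Finset.sum_add_distrib]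
    simp only [← Finset.sum_coe_sort L, hll, hrr, hlr]
    rw [Finset.sum_comm (f := fun (j i : L) =>
      Φ (.inr j) (.inl i) (∑ r, star (x r (.inr j)) * x r (.inl i)))]
    simp only [hrl]
    simp only [Complex.re_sum, Matrix.trace, Matrix.diag, Matrix.of_apply] at hmain
    simp only [Finset.sum_ite_eq, Finset.mem_univ, if_true]
    linarith
  obtain ⟨k, hk, hkD⟩ := exists_isPosKernel_extension _ herm _ hone hstar hpos
  have h1 : t 1 = 1 := by simpa using ht1 1
  have h2 : t (Complex.I • (1 : A)) = 0 := by simpa using ht1 Complex.I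
  refine ⟨k, hk, fun i j => ?_, fun i j => ?_, fun i j a => ?_⟩
  · rw [hkD _ _ _ (Submodule.mem_span_singleton_self (1 : A))]
    by_cases hij : i = j <;> simp [cbPrescription, hij, h1, h2]
  · rw [hkD _ _ _ (Submodule.mem_span_singleton_self (1 : A))]
    by_cases hij : i = j <;> simp [cbPrescription, hij, h1, h2]
  · rw [hkD (.inl i) (.inr j) a (Submodule.mem_top (R := ℂ))]
    have h3 : ∀ b, cbPrescription φ.1 e t (.inl i) (.inr j) b =
      (⟪e i, (φ : A →ₗ[ℂ] (H →L[ℂ] H)) b (e j)⟫_ℂ).re := fun b => rfl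
    rw [h3, h3, map_smul, smul_apply, inner_smul_right]
    apply Complex.ext <;> simp

end Dilation

/-! ### Existence of universal regular models -/

section Model

/-- An orthonormal family indexed by a Hilbert basis is the image of the basis under an isometry. -/
lemma HilbertBasis.exists_isometry {H : Type*} [NormedAddCommGroup H] [InnerProductSpace ℂ H]
    {K : Type*} [NormedAddCommGroup K] [InnerProductSpace ℂ K] [CompleteSpace K] {I : Type*}
    (b : HilbertBasis I ℂ H) {v : I → K} (hv : Orthonormal ℂ v) :
    ∃ S : H →L[ℂ] K, (∀ h, ‖S h‖ = ‖h‖) ∧ ∀ i, S (b i) = v i := by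
  classical
  let T : H →ₗᵢ[ℂ] K := hv.orthogonalFamily.linearIsometry.comp b.repr.toLinearIsometry
  refine ⟨T.toContinuousLinearMap, T.norm_map, fun i => ?_⟩
  change hv.orthogonalFamily.linearIsometry (b.repr (b i)) = v i
  rw [b.repr_self, OrthogonalFamily.linearIsometry_apply_single]
  simp

variable {A : Type u} [CStarAlgebra A]
variable {H : Type v} [NormedAddCommGroup H] [InnerProductSpace ℂ H] [CompleteSpace H]

section Triple

variable {K : Type w} [NormedAddCommGroup K] [InnerProductSpace ℂ K]

/-- The inclusion of `K` as the `j`-th summand of `K ⊕ K ⊕ K`. -/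
def incl (j : Fin 3) : K →L[ℂ] PiLp 2 (fun _ : Fin 3 => K) :=
  ((PiLp.continuousLinearEquiv 2 ℂ fun _ : Fin 3 => K).symm :
    (Fin 3 → K) →L[ℂ] PiLp 2 (fun _ : Fin 3 => K)) ∘L
    ContinuousLinearMap.single ℂ (fun _ : Fin 3 => K) j

lemma incl_apply (j l : Fin 3) (x : K) : incl j x l = if l = j then x else 0 := by
  change (Pi.single j x : Fin 3 → K) l = _
  rw [Pi.single_apply]

lemma inner_incl (j l : Fin 3) (x y : K) :
    ⟪incl j x, incl l y⟫_ℂ = if j = l then ⟪x, y⟫_ℂ else 0 := by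
  rw [PiLp.inner_apply, Finset.sum_eq_single j]
  · by_cases h : j = l <;> simp [incl_apply, h]
  · intro i _ hi
    simp [incl_apply, hi]
  · simp

variable [CompleteSpace K]

lemma adjoint_incl_apply (j l : Fin 3) (x : K) :
    ContinuousLinearMap.adjoint (incl j) (incl l x) = if j = l then x else 0 := by
  refine ext_inner_left ℂ fun y => ?_
  rw [ContinuousLinearMap.adjoint_inner_right, inner_incl]
  split_ifs <;> simp

/-- The map `B : x ↦ (2 x, 0, 0)` of `K` into `K ⊕ K ⊕ K`. Its norm exceeds `1` to leave room in
`exists_model_isometry`, where `B* V` is to be an isometry. -/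
def modelIn : K →L[ℂ] PiLp 2 (fun _ : Fin 3 => K) := (2 : ℂ) • incl 0

/-- The map `C : (x, y, z) ↦ x / 2 + 4 y` of `K ⊕ K ⊕ K` onto `K`, a left inverse of `modelIn`. -/
def modelOut : PiLp 2 (fun _ : Fin 3 => K) →L[ℂ] K :=
  (1 / 2 : ℂ) • ContinuousLinearMap.adjoint (incl 0) +
    (4 : ℂ) • ContinuousLinearMap.adjoint (incl 1)

lemma modelOut_modelIn (x : K) : modelOut (modelIn x) = x := by
  simp [modelOut, modelIn, adjoint_incl_apply, smul_smul]

lemma adjoint_modelIn : ContinuousLinearMap.adjoint (modelIn (K := K)) =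
    (2 : ℂ) • ContinuousLinearMap.adjoint (incl 0) := by
  rw [modelIn, map_smulₛₗ, map_ofNat]

lemma adjoint_modelOut : ContinuousLinearMap.adjoint (modelOut (K := K)) =
    (1 / 2 : ℂ) • incl 0 + (4 : ℂ) • incl 1 := by
  rw [modelOut, map_add, map_smulₛₗ, map_smulₛₗ, map_div₀, map_one, map_ofNat, map_ofNat,
    ContinuousLinearMap.adjoint_adjoint, ContinuousLinearMap.adjoint_adjoint]

lemma adjoint_modelIn_modelIn (x : K) :
    ContinuousLinearMap.adjoint modelIn (modelIn x) = (4 : ℂ) • x := by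
  rw [adjoint_modelIn]
  simp [modelIn, adjoint_incl_apply, smul_smul]
  norm_num

lemma modelOut_adjoint_modelOut (x : K) :
    modelOut (ContinuousLinearMap.adjoint modelOut x) = (1 / 4 + 16 : ℂ) • x := by
  rw [adjoint_modelOut]
  simp [modelOut, adjoint_incl_apply, smul_smul, ← add_smul]
  norm_num

/-- The homomorphism `a ↦ B π(a) C`, with `B = modelIn` and `C = modelOut`. It is multiplicative
because `C B = 1`, but neither unital nor `*`-preserving. -/
def modelHom (π : A →⋆ₐ[ℂ] (K →L[ℂ] K)) :
    A →ₙₐ[ℂ] (PiLp 2 (fun _ : Fin 3 => K) →L[ℂ] PiLp 2 (fun _ : Fin 3 => K)) where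
  toFun a := modelIn ∘L π a ∘L modelOut
  map_smul' c a := by ext1 x; simp
  map_zero' := by ext1 x; simp
  map_add' a b := by ext1 x; simp
  map_mul' a b := by ext1 x; simp [modelOut_modelIn]

/-- Regularity: `B* B` and `C C*` are scalars, so `u` drops out of the two products. -/
lemma modelHom_regular (π : A →⋆ₐ[ℂ] (K →L[ℂ] K)) {u : A} (hu : u ∈ unitary A) :
    star (modelHom π u) * modelHom π u =
        (4 : ℂ) • (ContinuousLinearMap.adjoint modelOut ∘L modelOut) ∧
      modelHom π u * star (modelHom π u) =
        (1 / 4 + 16 : ℂ) • (modelIn ∘L ContinuousLinearMap.adjoint modelIn) := by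
  have h1 : ∀ x, ContinuousLinearMap.adjoint (π u) (π u x) = x := fun x => by
    rw [← ContinuousLinearMap.star_eq_adjoint, ← map_star, ← mul_apply_eq_comp, ← map_mul,
      (Unitary.mem_iff.1 hu).1, map_one, one_apply_eq_self]
  have h2 : ∀ x, π u (ContinuousLinearMap.adjoint (π u) x) = x := fun x => by
    rw [← ContinuousLinearMap.star_eq_adjoint, ← map_star, ← mul_apply_eq_comp, ← map_mul,
      (Unitary.mem_iff.1 hu).2, map_one, one_apply_eq_self]
  have h3 : star (modelHom π u) = ContinuousLinearMap.adjoint modelOut ∘L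
      ContinuousLinearMap.adjoint (π u) ∘L ContinuousLinearMap.adjoint modelIn := by
    change ContinuousLinearMap.adjoint (modelIn ∘L π u ∘L modelOut) = _
    rw [ContinuousLinearMap.adjoint_comp, ContinuousLinearMap.adjoint_comp]
    rfl
  have h4 : ∀ x, modelHom π u x = modelIn (π u (modelOut x)) := fun x => rfl
  rw [h3]
  constructor
  · ext1 x
    simp [h4, adjoint_modelIn_modelIn, h1]
  · ext1 x
    simp [h4, modelOut_adjoint_modelOut, h2]

/-- Any two isometries `S`, `T` have the form `S = B* V`, `T = C V` with one isometry `V`. The first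
component of `V` is forced to be `S / 2` and the second to be `(T - S / 4) / 4`; the third is
free. -/
lemma exists_model_isometry {S T : H →L[ℂ] K} (hS : ∀ h, ‖S h‖ = ‖h‖) (hT : ∀ h, ‖T h‖ = ‖h‖) :
    ∃ V : H →L[ℂ] PiLp 2 (fun _ : Fin 3 => K), Isometry V ∧
      ContinuousLinearMap.adjoint modelIn ∘L V = S ∧ modelOut ∘L V = T := by
  set Q : H →L[ℂ] K := T - (1 / 4 : ℂ) • S with hQ
  have hQn : ‖Q‖ ≤ 5 / 4 := by
    refine ContinuousLinearMap.opNorm_le_bound _ (by norm_num) fun h => ?_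
    have : Q h = T h - (1 / 4 : ℂ) • S h := rfl
    rw [this]
    refine (norm_sub_le _ _).trans ?_
    rw [norm_smul, hS, hT]
    norm_num
    linarith
  -- The third summand makes up for the missing norm.
  obtain ⟨D, hD⟩ : ∃ D : H →L[ℂ] H, ∀ h, ‖D h‖ ^ 2 = 3 / 4 * ‖h‖ ^ 2 - 1 / 16 * ‖Q h‖ ^ 2 := by
    let G : H →L[ℂ] H := ((3 / 4 : ℝ) : ℂ) • 1 - ((1 / 16 : ℝ) : ℂ) •
      (ContinuousLinearMap.adjoint Q ∘L Q)
    have hGi : ∀ h, ⟪h, G h⟫_ℂ = ((3 / 4 * ‖h‖ ^ 2 - 1 / 16 * ‖Q h‖ ^ 2 : ℝ) : ℂ) := fun h => by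
      change ⟪h, ((3 / 4 : ℝ) : ℂ) • h -
        ((1 / 16 : ℝ) : ℂ) • ContinuousLinearMap.adjoint Q (Q h)⟫_ℂ = _
      rw [inner_sub_right, inner_smul_right, inner_smul_right,
        ContinuousLinearMap.adjoint_inner_right, inner_self_eq_ofReal_norm_sq,
        inner_self_eq_ofReal_norm_sq, ← Complex.ofReal_mul, ← Complex.ofReal_mul,
        ← Complex.ofReal_sub]
    have hG : 0 ≤ G := by
      rw [ContinuousLinearMap.nonneg_iff_isPositive, ContinuousLinearMap.isPositive_iff_complex]
      intro h
      have h1 : ⟪G h, h⟫_ℂ = ((3 / 4 * ‖h‖ ^ 2 - 1 / 16 * ‖Q h‖ ^ 2 : ℝ) : ℂ) := by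
        rw [← inner_conj_symm, hGi, Complex.conj_ofReal]
      rw [h1]
      refine ⟨rfl, ?_⟩
      have h2 : ‖Q h‖ ≤ 5 / 4 * ‖h‖ := Q.le_of_opNorm_le hQn h
      have h3 : ‖Q h‖ ^ 2 ≤ (5 / 4 * ‖h‖) ^ 2 := by gcongr
      change 0 ≤ 3 / 4 * ‖h‖ ^ 2 - 1 / 16 * ‖Q h‖ ^ 2
      nlinarith [sq_nonneg ‖h‖]
    obtain ⟨D, hD⟩ := CStarAlgebra.nonneg_iff_eq_star_mul_self.1 hG
    refine ⟨D, fun h => ?_⟩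
    have h1 := hGi h
    rw [hD, mul_apply_eq_comp, ContinuousLinearMap.star_eq_adjoint,
      ContinuousLinearMap.adjoint_inner_right, inner_self_eq_ofReal_norm_sq] at h1
    exact_mod_cast h1
  refine ⟨(1 / 2 : ℂ) • incl 0 ∘L S + (1 / 4 : ℂ) • incl 1 ∘L Q + incl 2 ∘L S ∘L D, ?_, ?_, ?_⟩
  · refine AddMonoidHomClass.isometry_of_norm _ fun h => ?_
    refine (sq_eq_sq₀ (norm_nonneg _) (norm_nonneg _)).1 ?_
    rw [PiLp.norm_sq_eq_of_L2, Fin.sum_univ_three]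
    simp only [add_apply, smul_apply, ContinuousLinearMap.comp_apply, PiLp.add_apply,
      PiLp.smul_apply, incl_apply]
    simp [norm_smul, hS, mul_pow, hD]
    ring
  · ext1 h
    rw [adjoint_modelIn]
    simp [adjoint_incl_apply, smul_smul]
  · ext1 h
    simp [modelOut, adjoint_incl_apply, smul_smul, hQ]
    norm_num
    module

end Triple

variable [PartialOrder A] [StarOrderedRing A]

variable (A H) in
/-- One representation dilates all completely contractive maps: it is built from the block sum of
their dilation kernels. -/
lemma exists_universal_rep [Nontrivial A] : ∃ r : HilbertRep.{u, max u v} A,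
    ∀ φ : CBMaps A H, cbNorm φ ≤ 1 → ∃ S T : H →L[ℂ] r.K, (∀ h, ‖S h‖ = ‖h‖) ∧
      (∀ h, ‖T h‖ = ‖h‖) ∧ ∀ a, (φ : A →ₗ[ℂ] (H →L[ℂ] H)) a =
        ContinuousLinearMap.adjoint S ∘L r.π a ∘L T := by
  classical
  obtain ⟨I, b, hb⟩ := exists_hilbertBasis ℂ H
  choose k hk hk₁ hk₂ hk₁₂ using fun φ : {φ : CBMaps A H // cbNorm φ ≤ 1} =>
    exists_cbKernel φ.2 b.orthonormal
  obtain ⟨r, w, hw⟩ := exists_kernelRep (isPosKernel_sigmaKernel hk)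
  have hin : ∀ φ p q a, ⟪w ⟨φ, p⟩, r.π a (w ⟨φ, q⟩)⟫_ℂ = k φ p q a := fun φ p q a => by
    rw [hw, sigmaKernel_self]
  have hin1 : ∀ φ p q, ⟪w ⟨φ, p⟩, w ⟨φ, q⟩⟫_ℂ = k φ p q 1 :=
    fun φ p q => by
      rw [← hin, map_one, one_apply_eq_self]
  refine ⟨r, fun φ hφ => ?_⟩
  obtain ⟨S, hS, hSb⟩ := b.exists_isometry (v := fun i => w ⟨⟨φ, hφ⟩, .inl i⟩)
    (orthonormal_iff_ite.2 fun i j => by rw [hin1, hk₁])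
  obtain ⟨T, hT, hTb⟩ := b.exists_isometry (v := fun i => w ⟨⟨φ, hφ⟩, .inr i⟩)
    (orthonormal_iff_ite.2 fun i j => by rw [hin1, hk₂])
  refine ⟨S, T, hS, hT, fun a => ?_⟩
  refine ContinuousLinearMap.ext_on
    (Submodule.dense_iff_topologicalClosure_eq_top.2 b.dense_span) ?_
  rintro _ ⟨j, rfl⟩
  refine b.repr.injective (lp.ext (funext fun i => ?_))
  rw [b.repr_apply_apply, b.repr_apply_apply, ContinuousLinearMap.comp_apply,
    ContinuousLinearMap.adjoint_inner_right, ContinuousLinearMap.comp_apply, hSb, hTb, hin, hk₁₂]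

variable (A H) in
/-- Universal regular models exist. -/
lemma nonempty_univRegModel [Nontrivial A] : Nonempty (UnivRegModel.{u, v, max u v} A H) := by
  obtain ⟨r, hr⟩ := exists_universal_rep A H
  refine ⟨{ K := PiLp 2 (fun _ : Fin 3 => r.K)
            τ := modelHom r.π
            regular := fun u hu => ?_
            universal := fun φ hφ => ?_ }⟩
  · rw [(modelHom_regular r.π hu).1, (modelHom_regular r.π hu).2,
      (modelHom_regular r.π (one_mem _)).1, (modelHom_regular r.π (one_mem _)).2]
    exact ⟨rfl, rfl⟩
  · obtain ⟨S, T, hS, hT, hST⟩ := hr φ hφ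
    obtain ⟨V, hV, hVS, hVT⟩ := exists_model_isometry hS hT
    refine ⟨V, hV, fun a => ?_⟩
    rw [hST, ← hVS, ← hVT, ContinuousLinearMap.adjoint_comp, ContinuousLinearMap.adjoint_adjoint]
    rfl

end Model

/-! ### The regular distance -/

section Regular

variable {A : Type u} [CStarAlgebra A] [PartialOrder A] [StarOrderedRing A]
variable {H : Type v} [NormedAddCommGroup H] [InnerProductSpace ℂ H] [CompleteSpace H]

lemma cbNorm_pos {φ : CBMaps A H} (hφ : φ ≠ 0) : 0 < cbNorm φ := by
  refine (cbNorm_nonneg φ).lt_of_ne fun h => hφ (Subtype.ext (LinearMap.ext fun a => ?_))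
  have h1 := norm_map_le_cbNorm φ (CStarMatrix.ofMatrix fun _ _ : Fin 1 => a)
  rw [← h, zero_mul, norm_le_zero_iff] at h1
  exact congrFun (congrFun h1 0) 0

lemma cbNorm_inv_smul_le (φ : CBMaps A H) : cbNorm ((cbNorm φ : ℂ)⁻¹ • φ) ≤ 1 := by
  refine Real.sSup_le ?_ zero_le_one
  rintro _ ⟨n, M, hM, rfl⟩
  have h : M.map (((cbNorm φ : ℂ)⁻¹ • φ : CBMaps A H) : A →ₗ[ℂ] (H →L[ℂ] H)) =
      (cbNorm φ : ℂ)⁻¹ • M.map (φ : A →ₗ[ℂ] (H →L[ℂ] H)) := by ext; simp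
  rw [h, norm_smul, norm_inv, Complex.norm_real, Real.norm_of_nonneg (cbNorm_nonneg φ)]
  have h1 : ‖M.map (φ : A →ₗ[ℂ] (H →L[ℂ] H))‖ ≤ cbNorm φ :=
    (norm_map_le_cbNorm φ M).trans (mul_le_of_le_one_right (cbNorm_nonneg φ) hM)
  exact (mul_le_mul_of_nonneg_left h1 (inv_nonneg.2 (cbNorm_nonneg φ))).trans inv_mul_le_one

/-- The only use of universality of the model. -/
lemma implementers_nonempty (m : UnivRegModel.{u, v, w} A H) (φ : CBMaps A H) :
    (implementers m φ).Nonempty := by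
  by_cases h : φ = 0
  · exact ⟨0, .inl ⟨h, rfl⟩⟩
  · obtain ⟨V, hV, hφV⟩ := m.universal _ (cbNorm_inv_smul_le φ)
    exact ⟨_, .inr ⟨h, V, hV, hφV, rfl⟩⟩

lemma apply_eq_of_mem_implementers {m : UnivRegModel.{u, v, w} A H} {φ : CBMaps A H}
    {W : H →L[ℂ] m.K} (hW : W ∈ implementers m φ) (a : A) :
    (φ : A →ₗ[ℂ] (H →L[ℂ] H)) a = ContinuousLinearMap.adjoint W ∘L m.τ a ∘L W := by
  rcases hW with ⟨rfl, rfl⟩ | ⟨h, V, -, hV, rfl⟩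
  · simp
  · have hc : (cbNorm φ : ℂ) ≠ 0 := Complex.ofReal_ne_zero.2 (cbNorm_pos h).ne'
    have h1 : (φ : A →ₗ[ℂ] (H →L[ℂ] H)) a =
        (cbNorm φ : ℂ) • ContinuousLinearMap.adjoint V ∘L m.τ a ∘L V := by
      rw [← hV, LinearMap.smul_apply, smul_inv_smul₀ hc]
    have h2 : (cbNorm φ : ℂ) = (√(cbNorm φ) : ℂ) * (√(cbNorm φ) : ℂ) := by
      rw [← Complex.ofReal_mul, Real.mul_self_sqrt (cbNorm_nonneg φ)]
    rw [h1, map_smulₛₗ, Complex.conj_ofReal, h2, mul_smul]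
    ext x
    simp

lemma norm_le_of_mem_implementers {m : UnivRegModel.{u, v, w} A H} {φ : CBMaps A H}
    {W : H →L[ℂ] m.K} (hW : W ∈ implementers m φ) : ‖W‖ ≤ √(cbNorm φ) := by
  rcases hW with ⟨-, rfl⟩ | ⟨-, V, hV, -, rfl⟩
  · simp
  · rw [norm_smul, Complex.norm_real, Real.norm_of_nonneg (Real.sqrt_nonneg _)]
    refine mul_le_of_le_one_right (Real.sqrt_nonneg _) ?_
    refine ContinuousLinearMap.opNorm_le_bound _ zero_le_one fun x => ?_
    rw [one_mul, hV.norm_map_of_map_zero (map_zero V)]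

lemma gammaMap_sub (m : UnivRegModel.{u, v, w} A H) (V W : H →L[ℂ] m.K) :
    gammaMap m V - gammaMap m W = gammaMap m (V - W) := by
  ext1 x
  simp only [gammaMap, sub_apply, smul_apply, ContinuousLinearMap.comp_apply,
    ContinuousLinearMap.prod_apply, ← smul_sub, ← map_sub, Prod.mk_sub_mk]

lemma norm_gammaMap_apply_sq (m : UnivRegModel.{u, v, w} A H) (W : H →L[ℂ] m.K) (x : H) :
    ‖gammaMap m W x‖ ^ 2 = (‖W x‖ ^ 2 + ‖m.τ 1 (W x)‖ ^ 2) / 2 := by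
  have h : gammaMap m W x = ((1 / √2 : ℝ) : ℂ) • WithLp.toLp 2 (W x, m.τ 1 (W x)) := rfl
  rw [h, norm_smul, mul_pow, WithLp.prod_norm_sq_eq_of_L2, Complex.norm_real, Real.norm_eq_abs,
    sq_abs, div_pow, Real.sq_sqrt zero_le_two]
  change _ * (‖W x‖ ^ 2 + ‖m.τ 1 (W x)‖ ^ 2) = _
  ring

lemma cPlus_pos (m : UnivRegModel.{u, v, w} A H) : 0 < cPlus m := by
  unfold cPlus
  positivity

lemma norm_gammaMap_le (m : UnivRegModel.{u, v, w} A H) (W : H →L[ℂ] m.K) :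
    ‖gammaMap m W‖ ≤ cPlus m * ‖W‖ := by
  refine ContinuousLinearMap.opNorm_le_bound _ (by have := cPlus_pos m; positivity) fun x => ?_
  refine le_of_sq_le_sq ?_ (by have := cPlus_pos m; positivity)
  rw [norm_gammaMap_apply_sq, mul_pow, mul_pow, cPlus, div_pow, Real.sq_sqrt (by positivity),
    Real.sq_sqrt zero_le_two]
  have h1 : ‖W x‖ ^ 2 ≤ (‖W‖ * ‖x‖) ^ 2 := by gcongr; exact W.le_opNorm x
  have h2 : ‖m.τ 1 (W x)‖ ^ 2 ≤ (‖m.τ 1‖ * ‖W x‖) ^ 2 := by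
    gcongr
    exact (m.τ 1).le_opNorm _
  have h3 : (‖m.τ 1‖ * ‖W x‖) ^ 2 ≤ ‖m.τ 1‖ ^ 2 * (‖W‖ * ‖x‖) ^ 2 := by
    rw [mul_pow]
    gcongr
  rw [mul_pow] at h1 h3
  linarith

lemma norm_le_norm_gammaMap (m : UnivRegModel.{u, v, w} A H) (W : H →L[ℂ] m.K) :
    ‖W‖ ≤ √2 * ‖gammaMap m W‖ := by
  refine ContinuousLinearMap.opNorm_le_bound _ (by positivity) fun x => ?_
  refine le_of_sq_le_sq ?_ (by positivity)
  have h1 : ‖gammaMap m W x‖ ^ 2 ≤ (‖gammaMap m W‖ * ‖x‖) ^ 2 := by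
    gcongr
    exact ContinuousLinearMap.le_opNorm _ x
  rw [norm_gammaMap_apply_sq] at h1
  rw [mul_assoc, mul_pow, Real.sq_sqrt zero_le_two]
  nlinarith [sq_nonneg ‖m.τ 1 (W x)‖]

lemma norm_le_of_mem_featureSet {m : UnivRegModel.{u, v, w} A H} {φ : CBMaps A H}
    {F : H →L[ℂ] WithLp 2 (m.K × m.K)} (hF : F ∈ featureSet m φ) :
    ‖F‖ ≤ cPlus m * √(cbNorm φ) := by
  obtain ⟨W, hW, rfl⟩ := hF
  exact (norm_gammaMap_le m W).trans
    (mul_le_mul_of_nonneg_left (norm_le_of_mem_implementers hW) (cPlus_pos m).le)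

lemma featureSet_nonempty (m : UnivRegModel.{u, v, w} A H) (φ : CBMaps A H) :
    (featureSet m φ).Nonempty :=
  (implementers_nonempty m φ).image _

lemma hausdorffEDist_featureSet_ne_top (m : UnivRegModel.{u, v, w} A H) (φ ψ : CBMaps A H) :
    Metric.hausdorffEDist (featureSet m φ) (featureSet m ψ) ≠ ⊤ :=
  Metric.hausdorffEDist_ne_top_of_nonempty_of_bounded (featureSet_nonempty m φ)
    (featureSet_nonempty m ψ)
    (isBounded_iff_forall_norm_le.2 ⟨_, fun _ => norm_le_of_mem_featureSet⟩)
    (isBounded_iff_forall_norm_le.2 ⟨_, fun _ => norm_le_of_mem_featureSet⟩)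

/-- The normalized model distances are bounded independently of the model. -/
lemma deltaRegModel_le (m : UnivRegModel.{u, v, w} A H) (φ ψ : CBMaps A H) :
    1 / cPlus m * deltaRegModel m φ ψ ≤ √(cbNorm φ) + √(cbNorm ψ) := by
  have hc := cPlus_pos m
  rw [one_div, inv_mul_le_iff₀ hc, mul_add]
  have key : ∀ χ ω : CBMaps A H, ∀ F ∈ featureSet m χ, ∃ G ∈ featureSet m ω,
      dist F G ≤ cPlus m * √(cbNorm χ) + cPlus m * √(cbNorm ω) := fun χ ω F hF => by
    obtain ⟨G, hG⟩ := featureSet_nonempty m ω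
    refine ⟨G, hG, ?_⟩
    exact (dist_le_norm_add_norm F G).trans
      (add_le_add (norm_le_of_mem_featureSet hF) (norm_le_of_mem_featureSet hG))
  refine Metric.hausdorffDist_le_of_mem_dist (by positivity) (key φ ψ) fun F hF => ?_
  rw [add_comm]
  exact key ψ φ F hF

lemma bddAbove_deltaReg (φ ψ : CBMaps A H) : BddAbove (Set.range
    fun m : UnivRegModel.{u, v, max u v} A H => 1 / cPlus m * deltaRegModel m φ ψ) :=
  ⟨_, Set.forall_mem_range.2 fun m => deltaRegModel_le m φ ψ⟩

lemma deltaReg_nonneg (φ ψ : CBMaps A H) : 0 ≤ deltaReg φ ψ :=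
  Real.iSup_nonneg fun m =>
    mul_nonneg (one_div_nonneg.2 (cPlus_pos m).le) Metric.hausdorffDist_nonneg

lemma deltaReg_self (φ : CBMaps A H) : deltaReg φ φ = 0 := by
  simp [deltaReg, deltaRegModel]

lemma deltaReg_comm (φ ψ : CBMaps A H) : deltaReg φ ψ = deltaReg ψ φ := by
  simp only [deltaReg, deltaRegModel, Metric.hausdorffDist_comm]

lemma deltaReg_triangle (φ ψ χ : CBMaps A H) :
    deltaReg φ χ ≤ deltaReg φ ψ + deltaReg ψ χ := by
  refine Real.iSup_le (fun m => ?_) (add_nonneg (deltaReg_nonneg _ _) (deltaReg_nonneg _ _))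
  refine le_trans ?_ (add_le_add (le_ciSup (bddAbove_deltaReg φ ψ) m)
    (le_ciSup (bddAbove_deltaReg ψ χ) m))
  rw [← mul_add]
  exact mul_le_mul_of_nonneg_left
    (Metric.hausdorffDist_triangle (hausdorffEDist_featureSet_ne_top m φ ψ))
    (one_div_nonneg.2 (cPlus_pos m).le)

/-- A single model separates points: implementers `V` of `φ` and `W` of `ψ` can be chosen with
`V - W` small, and then `φ(a) - ψ(a) = V* τ(a) V - W* τ(a) W` is small. -/
lemma eq_of_deltaRegModel_eq_zero {m : UnivRegModel.{u, v, w} A H} {φ ψ : CBMaps A H}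
    (h : deltaRegModel m φ ψ = 0) : φ = ψ := by
  refine Subtype.ext (LinearMap.ext fun a => ?_)
  set C : ℝ := ‖m.τ a‖ * (√(cbNorm φ) + √(cbNorm ψ)) * √2 with hC
  have hC0 : 0 ≤ C := by positivity
  rw [← sub_eq_zero, ← norm_le_zero_iff]
  refine le_of_forall_pos_le_add fun ε hε => ?_
  have hδ : 0 < ε / (C + 1) := by positivity
  obtain ⟨_, ⟨V, hV, rfl⟩⟩ := featureSet_nonempty m φ
  obtain ⟨_, ⟨W, hW, rfl⟩, hVW⟩ := Metric.exists_dist_lt_of_hausdorffDist_lt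
    (Set.mem_image_of_mem (gammaMap m) hV) (h.trans_lt hδ) (hausdorffEDist_featureSet_ne_top m φ ψ)
  replace hVW : ‖gammaMap m V - gammaMap m W‖ < ε / (C + 1) :=
    (dist_eq_norm (gammaMap m V) (gammaMap m W)).symm.trans_lt hVW
  rw [gammaMap_sub] at hVW
  have hVW' : ‖V - W‖ ≤ √2 * (ε / (C + 1)) :=
    (norm_le_norm_gammaMap m _).trans (by gcongr)
  have hnV := norm_le_of_mem_implementers hV
  have hnW := norm_le_of_mem_implementers hW
  rw [zero_add, apply_eq_of_mem_implementers hV, apply_eq_of_mem_implementers hW]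
  calc _ ≤ ‖m.τ a‖ * (‖V‖ + ‖W‖) * ‖V - W‖ := norm_compression_sub_le _ _ _
    _ ≤ ‖m.τ a‖ * (√(cbNorm φ) + √(cbNorm ψ)) * (√2 * (ε / (C + 1))) := by gcongr
    _ = ε / (C + 1) * C := by rw [hC]; ring
    _ ≤ ε / (C + 1) * (C + 1) := by gcongr; linarith
    _ = ε := by field_simp

lemma eq_of_deltaReg_eq_zero {φ ψ : CBMaps A H} (h : deltaReg φ ψ = 0) : φ = ψ := by
  -- Models are constructed for `A ≠ 0`; on the zero algebra all maps are equal.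
  rcases subsingleton_or_nontrivial A with hA | hA
  · refine Subtype.ext (LinearMap.ext fun a => ?_)
    rw [Subsingleton.elim a 0, map_zero, map_zero]
  · obtain ⟨m⟩ := nonempty_univRegModel A H
    refine eq_of_deltaRegModel_eq_zero (m := m) (le_antisymm ?_ Metric.hausdorffDist_nonneg)
    have h1 : 1 / cPlus m * deltaRegModel m φ ψ ≤ 0 :=
      (le_ciSup (bddAbove_deltaReg φ ψ) m).trans_eq h
    exact nonpos_of_mul_nonpos_right h1 (one_div_pos.2 (cPlus_pos m))

end Regular

/-! ### The collapsed space -/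

section Snowflake

variable {A : Type u} [CStarAlgebra A] [PartialOrder A] [StarOrderedRing A]
variable {H : Type v} [NormedAddCommGroup H] [InnerProductSpace ℂ H] [CompleteSpace H]

variable (A H) in
lemma zero_mem_CPCone : (0 : CBMaps A H) ∈ CPCone A H :=
  ⟨{ (0 : A →ₗ[ℂ] (H →L[ℂ] H)) with
      map_cstarMatrix_nonneg' := fun k M _ => by
        have : M.map (0 : A →ₗ[ℂ] (H →L[ℂ] H)) = 0 := by ext; simp
        exact this.ge }, rfl⟩

/-- The underlying map of a point of `𝒴`, with the base point sent to `0`. -/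
def NonCPSpace.toCBMaps : NonCPSpace A H → CBMaps A H
  | .base => 0
  | .of φ _ => φ

/-- The point `0` represents the base point faithfully because `0` is completely positive. -/
lemma NonCPSpace.toCBMaps_injective :
    Function.Injective (NonCPSpace.toCBMaps : NonCPSpace A H → CBMaps A H) := by
  rintro (_ | ⟨φ, hφ⟩) (_ | ⟨ψ, hψ⟩) h
  · rfl
  · exact absurd ((show (0 : CBMaps A H) = ψ from h) ▸ zero_mem_CPCone A H) hψ
  · exact absurd ((show φ = 0 from h) ▸ zero_mem_CPCone A H) hφ
  · obtain rfl : φ = ψ := h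
    rfl

/-- The distance `d_reg` is pulled back from `λ δ_reg ^ α`. At the base point this uses
`0 ^ α = 0`. -/
lemma dReg_eq {α : ℝ} (hα : α ≠ 0) (lam : ℝ) (x y : NonCPSpace A H) :
    dReg lam α x y = lam * deltaReg x.toCBMaps y.toCBMaps ^ α := by
  rcases x with _ | ⟨φ, hφ⟩ <;> rcases y with _ | ⟨ψ, hψ⟩
  · simp [dReg, NonCPSpace.toCBMaps, deltaReg_self, Real.zero_rpow hα]
  · simp [dReg, NonCPSpace.toCBMaps, rho, deltaReg_comm]
  · rfl
  · rfl

/-- The metric `d_reg` on `𝒴`: a snowflake of the metric `δ_reg`. -/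
abbrev nonCPMetricSpace {lam α : ℝ} (hlam : 0 < lam) (hα0 : 0 < α) (hα1 : α ≤ 1) :
    MetricSpace (NonCPSpace A H) where
  dist := dReg lam α
  dist_self x := by rw [dReg_eq hα0.ne', deltaReg_self, Real.zero_rpow hα0.ne', mul_zero]
  dist_comm x y := by rw [dReg_eq hα0.ne', dReg_eq hα0.ne', deltaReg_comm]
  dist_triangle x y z := by
    simp only [dReg_eq hα0.ne', ← mul_add]
    refine mul_le_mul_of_nonneg_left ?_ hlam.le
    exact (Real.rpow_le_rpow (deltaReg_nonneg _ _) (deltaReg_triangle _ _ _) hα0.le).trans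
      (Real.rpow_add_le_add_rpow (deltaReg_nonneg _ _) (deltaReg_nonneg _ _) hα0.le hα1)
  eq_of_dist_eq_zero {x y} h := by
    change dReg lam α x y = 0 at h
    rw [dReg_eq hα0.ne', mul_eq_zero, or_iff_right hlam.ne',
      Real.rpow_eq_zero (deltaReg_nonneg _ _) hα0.ne'] at h
    exact NonCPSpace.toCBMaps_injective (eq_of_deltaReg_eq_zero h)

end Snowflake

/-! ### The Kuratowski coordinate and the wedge -/

section Kuratowski

variable {A : Type u} [CStarAlgebra A] [PartialOrder A] [StarOrderedRing A]
variable {H : Type v} [NormedAddCommGroup H] [InnerProductSpace ℂ H] [CompleteSpace H]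

lemma bures_nonneg (φ ψ : CPCone A H) : 0 ≤ bures φ ψ := ENNReal.toReal_nonneg

lemma abs_bures_sub_le (φ ψ η : CPCone A H) : |bures φ η - bures ψ η| ≤ bures φ ψ := by
  rw [abs_sub_le_iff]
  constructor
  · linarith [bures_triangle φ ψ η]
  · linarith [bures_triangle ψ φ η, bures_comm φ ψ]

/-- The Kuratowski embedding is isometric: the supremum is attained at `η = ψ`. -/
lemma iSup_abs_bures_sub (φ ψ : CPCone A H) :
    ⨆ η, |bures φ η - bures ψ η| = bures φ ψ := by
  refine le_antisymm (Real.iSup_le (abs_bures_sub_le φ ψ) (bures_nonneg φ ψ)) ?_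
  have h := le_ciSup (f := fun η => |bures φ η - bures ψ η|)
    ⟨_, Set.forall_mem_range.2 (abs_bures_sub_le φ ψ)⟩ ψ
  simpa [bures_self, abs_of_nonneg (bures_nonneg φ ψ)] using h

variable (θ : CPCone A H)

lemma kappa_coe (φ η : CPCone A H) : kappa θ φ.1 η = bures φ η - bures θ η := dif_pos φ.2

lemma kappa_of_notMem {φ : CBMaps A H} (hφ : φ ∉ CPCone A H) (η : CPCone A H) :
    kappa θ φ η = 0 := dif_neg hφ

lemma kappaDist_comm (φ ψ : CBMaps A H) : kappaDist θ φ ψ = kappaDist θ ψ φ := by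
  simp only [kappaDist, abs_sub_comm]

lemma kappaDist_coe_coe (φ ψ : CPCone A H) : kappaDist θ φ.1 ψ.1 = bures φ ψ := by
  simp only [kappaDist, kappa_coe, sub_sub_sub_cancel_right, iSup_abs_bures_sub]

lemma kappaDist_coe_of_notMem (φ : CPCone A H) {ψ : CBMaps A H} (hψ : ψ ∉ CPCone A H) :
    kappaDist θ φ.1 ψ = bures φ θ := by
  simp only [kappaDist, kappa_coe, kappa_of_notMem θ hψ, sub_zero, iSup_abs_bures_sub]

lemma kappaDist_of_notMem {φ ψ : CBMaps A H} (hφ : φ ∉ CPCone A H) (hψ : ψ ∉ CPCone A H) :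
    kappaDist θ φ ψ = 0 := by
  simp [kappaDist, kappa_of_notMem θ hφ, kappa_of_notMem θ hψ]

variable (p : ℝ≥0∞)

open Classical in
/-- The bijection `J` of `𝒳` onto the wedge. The point of the wedge at which `𝒞` and `𝒴` are glued
comes from `θ`. -/
def wedgeEquiv : CBMaps A H ≃ LpWedge p θ (NonCPSpace.base : NonCPSpace A H) where
  toFun φ := if h : φ ∈ CPCone A H then LpWedge.inl p θ _ ⟨φ, h⟩ else LpWedge.inr p θ _ (.of φ h)
  invFun := Quot.lift
    (Sum.elim (fun φ => φ.1) fun y => match y with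
      | .base => θ.1
      | .of φ _ => φ)
    (by rintro _ _ ⟨⟩; rfl)
  left_inv φ := by
    by_cases h : φ ∈ CPCone A H
    · exact congrArg (Quot.lift _ _) (dif_pos h)
    · exact congrArg (Quot.lift _ _) (dif_neg h)
  right_inv := by
    rintro ⟨⟨φ, hφ⟩ | _ | ⟨φ, hφ⟩⟩
    · exact dif_pos hφ
    · exact (dif_pos θ.2).trans (Quot.sound WedgeRel.glue)
    · exact dif_neg hφ

lemma wedgeEquiv_coe (φ : CPCone A H) : wedgeEquiv θ p φ.1 = LpWedge.inl p θ _ φ := dif_pos φ.2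

lemma wedgeEquiv_of_notMem {φ : CBMaps A H} (hφ : φ ∉ CPCone A H) :
    wedgeEquiv θ p φ = LpWedge.inr p θ _ (.of φ hφ) := dif_neg hφ

variable {lam α : ℝ} [Fact (1 ≤ p)]

lemma buresKuratowski_coe_coe (hα : α ≠ 0) (φ ψ : CPCone A H) :
    buresKuratowski θ lam p α φ.1 ψ.1 = bures φ ψ := by
  rw [buresKuratowski, kappaDist_coe_coe, deltaRegTilde, if_pos φ.2, if_pos ψ.2,
    Real.zero_rpow hα, mul_zero, lpPair_left p (bures_nonneg φ ψ)]

lemma buresKuratowski_of_notMem (hlam : 0 ≤ lam) {φ ψ : CBMaps A H} (hφ : φ ∉ CPCone A H)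
    (hψ : ψ ∉ CPCone A H) :
    buresKuratowski θ lam p α φ ψ = dReg lam α (.of φ hφ) (.of ψ hψ) := by
  rw [buresKuratowski, kappaDist_of_notMem θ hφ hψ, deltaRegTilde, if_neg hφ, if_neg hψ,
    lpPair_right p (mul_nonneg hlam (Real.rpow_nonneg (deltaReg_nonneg _ _) _)), dReg]

lemma buresKuratowski_coe_of_notMem (φ : CPCone A H) {ψ : CBMaps A H} (hψ : ψ ∉ CPCone A H) :
    buresKuratowski θ lam p α φ.1 ψ = lpPair p (bures φ θ) (dReg lam α (.of ψ hψ) .base) := by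
  rw [buresKuratowski, kappaDist_coe_of_notMem θ φ hψ, deltaRegTilde, if_pos φ.2, if_neg hψ, dReg]

lemma buresKuratowski_of_notMem_coe {φ : CBMaps A H} (hφ : φ ∉ CPCone A H) (ψ : CPCone A H) :
    buresKuratowski θ lam p α φ ψ.1 = lpPair p (bures ψ θ) (dReg lam α (.of φ hφ) .base) := by
  rw [buresKuratowski, kappaDist_comm, kappaDist_coe_of_notMem θ ψ hφ, deltaRegTilde, if_neg hφ,
    if_pos ψ.2, dReg]

end Kuratowski

end

theorem mainTheorem2
    {A : Type u} [CStarAlgebra A] [PartialOrder A] [StarOrderedRing A]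
    {H : Type v} [NormedAddCommGroup H] [InnerProductSpace ℂ H] [CompleteSpace H]
    (θ : CPCone A H) (lam : ℝ) (hlam : 0 < lam) (α : ℝ) (hα0 : 0 < α) (hα1 : α ≤ 1)
    (p : ℝ≥0∞) [Fact (1 ≤ p)] :
    -- `β`, `d_reg` and `β^{BK}` are metrics on `𝒞`, `𝒴` and `𝒳`
    (∃ mX : MetricSpace (CBMaps A H),
      ∀ φ ψ : CBMaps A H, mX.dist φ ψ = buresKuratowski θ lam p α φ ψ) ∧
    ∃ (_ : MetricSpace (CPCone A H)) (_ : MetricSpace (NonCPSpace A H)),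
      (∀ φ ψ : CPCone A H, dist φ ψ = bures φ ψ) ∧
      (∀ x y : NonCPSpace A H, dist x y = dReg lam α x y) ∧
      -- `J` is an isometry of `(𝒳, β^{BK})` onto the wedge of `(𝒞, β, θ)` and `(𝒴, d_reg, ∗)`
      (∃ J : CBMaps A H ≃ LpWedge p θ (NonCPSpace.base : NonCPSpace A H),
        (∀ φ : CPCone A H, J φ.1 = LpWedge.inl p θ NonCPSpace.base φ) ∧
        (∀ (φ : CBMaps A H) (hφ : φ ∉ CPCone A H),
          J φ = LpWedge.inr p θ NonCPSpace.base (NonCPSpace.of φ hφ)) ∧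
        (∀ φ ψ : CBMaps A H, dist (J φ) (J ψ) = buresKuratowski θ lam p α φ ψ)) ∧
      -- the explicit formulas for `β^{BK}`
      (∀ φ ψ : CPCone A H, buresKuratowski θ lam p α φ.1 ψ.1 = bures φ ψ) ∧
      (∀ (φ ψ : CBMaps A H) (hφ : φ ∉ CPCone A H) (hψ : ψ ∉ CPCone A H),
        buresKuratowski θ lam p α φ ψ = dReg lam α (.of φ hφ) (.of ψ hψ) ∧
        dReg lam α (.of φ hφ) (.of ψ hψ) = lam * deltaReg φ ψ ^ α) ∧
      (∀ (φ : CPCone A H) (ψ : CBMaps A H) (hψ : ψ ∉ CPCone A H),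
        buresKuratowski θ lam p α φ.1 ψ = lpPair p (bures φ θ) (dReg lam α (.of ψ hψ) .base) ∧
        dReg lam α (.of ψ hψ) .base = lam * rho ψ ^ α) ∧
      (∀ (ψ : CPCone A H) (φ : CBMaps A H) (hφ : φ ∉ CPCone A H),
        buresKuratowski θ lam p α φ ψ.1 = lpPair p (bures ψ θ) (dReg lam α (.of φ hφ) .base) ∧
        dReg lam α (.of φ hφ) .base = lam * rho φ ^ α) := by
  let mC : MetricSpace (CPCone A H) := buresMetricSpace
  let mY : MetricSpace (NonCPSpace A H) := nonCPMetricSpace hlam hα0 hα1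
  have hJ : ∀ φ ψ : CBMaps A H,
      dist (wedgeEquiv θ p φ) (wedgeEquiv θ p ψ) = buresKuratowski θ lam p α φ ψ := by
    intro φ ψ
    by_cases hφ : φ ∈ CPCone A H <;> by_cases hψ : ψ ∈ CPCone A H
    · lift φ to CPCone A H using hφ
      lift ψ to CPCone A H using hψ
      rw [wedgeEquiv_coe, wedgeEquiv_coe, buresKuratowski_coe_coe θ p hα0.ne']
      rfl
    · lift φ to CPCone A H using hφ
      rw [wedgeEquiv_coe, wedgeEquiv_of_notMem θ p hψ, buresKuratowski_coe_of_notMem θ p φ hψ]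
      rfl
    · lift ψ to CPCone A H using hψ
      rw [wedgeEquiv_coe, wedgeEquiv_of_notMem θ p hφ, buresKuratowski_of_notMem_coe θ p hφ ψ]
      rfl
    · rw [wedgeEquiv_of_notMem θ p hφ, wedgeEquiv_of_notMem θ p hψ,
        buresKuratowski_of_notMem θ p hlam.le hφ hψ]
      rfl
  refine ⟨⟨MetricSpace.induced (wedgeEquiv θ p) (wedgeEquiv θ p).injective inferInstance, hJ⟩,
    mC, mY, fun _ _ => rfl, fun _ _ => rfl,
    ⟨wedgeEquiv θ p, wedgeEquiv_coe θ p, fun _ => wedgeEquiv_of_notMem θ p, hJ⟩,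
    buresKuratowski_coe_coe θ p hα0.ne',
    fun _ _ hφ hψ => ⟨buresKuratowski_of_notMem θ p hlam.le hφ hψ, rfl⟩,
    fun φ _ hψ => ⟨buresKuratowski_coe_of_notMem θ p φ hψ, rfl⟩,
    fun ψ _ hφ => ⟨buresKuratowski_of_notMem_coe θ p hφ ψ, rfl⟩⟩
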